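/- **Setting.** Let $A:\mathbb R\to M_n(\mathbb R)$ and $B:\mathbb R\to M_{n,m}(\mathbb R)$ be smooth and bounded, with $B(t)$ injective for every $t$, such that * for every $t$, $\mathrm{span}\{B_i(t)v : v\in\mathbb R^m,\ i\in\mathbb N\}=\mathbb R^n$, where $B_0=B$ and $B_{i+1}=\dot B_i-AB_i$; * $(A,B)$ is uniformly controllable: there are $s,\beta>0$ with $\int_t^{t+s}\Phi_A(t,\tau)B(\tau)B(\tau)^\top\Phi_A(t,\tau)^\top d\tau\succ\beta I$ for every $t\in\mathbb R$, where $\Phi_A$ is the transition matrix of $\dot x=A(t)x$. Let $\mathcal C_{LQ}$ be the set of costs $c(t,x,u)=x^\top Q(t)x+2x^\top S(t)u+u^\top R(t)u$ where $Q(t),R(t)$ are symmetric, $Q,S,R$ are smooth and bounded on $\mathbb R$, $R(t)\succ\alpha I$ for all $t$ for some $\alpha>0$, and $Q(t)-S(t)R(t)^{-1}S(t)^\top$ is positive semidefinite for every $t$. The optimal synthesis of $c$ is the set of all trajectories $x:[t_0,t_1]\to\mathbb R^n$ of $\dot x=A(t)x+B(t)u$ (over all $t_0<t_1$, with $u\in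 L^2([t_0,t_1];\mathbb R^m)$) that minimize $\int_{t_0}^{t_1}c(t,x(t),u(t))\,dt$ among the trajectories with the same end points $x(t_0),x(t_1)$. Two costs in $\mathcal C_{LQ}$ are equivalent if they have the same optimal synthesis. For $c\in\mathcal C_{LQ}$, the map $A_+$ of $c$ is $A_+=A-BR^{-1}(S^\top+B^\top P_+)$, where $P_+:\mathbb R\to\mathrm{Sym}(n)$ is a solution on all of $\mathbb R$ of the Riccati equation $$\dot P=-PA-A^\top P+(PB+S)R^{-1}(B^\top P+S^\top)-Q$$ for which $A_+$ is exponentially stable, i.e. $\|\Phi_{A_+}(t,t_0)\|\le\alpha e^{-\beta(t-t_0)}$ for all $t\ge t_0$ and some $\alpha,\beta>0$. The map $A_-$ of $c$ is $A_-=A-BR^{-1}(S^\top+B^\top P_-)$, where $P_-:\mathbb R\to\mathrm{Sym}(n)$ is a solution on $\mathbb R$ of the same equation for which $A_-$ is exponentially anti-stable, i.e. $\|\Phi_{A_-}(t,t_0)\|\le\alpha e^{\beta(t-t_0)}$ for all $t\le t_0$ and some $\alpha,\beta>0$. **Lemma.** Let $c,\tilde c\in\mathcal C_{LQ}$ be equivalent.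 Then $c$ and $\tilde c$ define the same maps $A_+$ and $A_-$: a map $X:\mathbb R\to M_n(\mathbb R)$ is an $A_+$ of $c$ if and only if it is an $A_+$ of $\tilde c$, and any $A_+$ of $c$ is equal to any $A_+$ of $\tilde c$; the same holds for $A_-$. Hence the optimal synthesis determines $(A_+,A_-)$ uniquely. -/

import Mathlib

open Matrix MeasureTheory Set
open scoped ContDiff Matrix.Norms.Elementwise

namespace LQ

noncomputable section

/-- `Φ` is the transition matrix of `ẋ = A(t) x`: for each `τ`, `Φ · τ` solves
`∂ₜ Φ(t, τ) = A(t) Φ(t, τ)` on all of `ℝ` with `Φ(τ, τ) = 1`. For a continuous `A` there is exactly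
one such `Φ`. -/
def IsTransitionMatrix {n : ℕ} (A : ℝ → Matrix (Fin n) (Fin n) ℝ)
    (Φ : ℝ → ℝ → Matrix (Fin n) (Fin n) ℝ) : Prop :=
  ∀ τ : ℝ, Φ τ τ = 1 ∧ ∀ t : ℝ, HasDerivAt (fun r => Φ r τ) (A t * Φ t τ) t

/-- `A` is exponentially stable: `‖Φ_A(t, t₀)‖ ≤ α exp (-β (t - t₀))` for `t ≥ t₀`. -/
def ExpStable {n : ℕ} (A : ℝ → Matrix (Fin n) (Fin n) ℝ) : Prop :=
  ∃ Φ, IsTransitionMatrix A Φ ∧ ∃ α > 0, ∃ β > 0, ∀ t₀ t : ℝ, t₀ ≤ t →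
    ‖Φ t t₀‖ ≤ α * Real.exp (-β * (t - t₀))

/-- `A` is exponentially anti-stable: `‖Φ_A(t, t₀)‖ ≤ α exp (β (t - t₀))` for `t ≤ t₀`. -/
def ExpAntiStable {n : ℕ} (A : ℝ → Matrix (Fin n) (Fin n) ℝ) : Prop :=
  ∃ Φ, IsTransitionMatrix A Φ ∧ ∃ α > 0, ∃ β > 0, ∀ t₀ t : ℝ, t ≤ t₀ →
    ‖Φ t t₀‖ ≤ α * Real.exp (β * (t - t₀))

/-- A matrix-valued map that is smooth (`C^∞`) and bounded on `ℝ`. -/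
def SmoothBounded {n m : ℕ} (F : ℝ → Matrix (Fin n) (Fin m) ℝ) : Prop :=
  ContDiff ℝ ∞ F ∧ ∃ C : ℝ, ∀ t, ‖F t‖ ≤ C

/-- The maps `B₀ = B`, `Bᵢ₊₁ = dBᵢ/dt - A Bᵢ`. -/
def kalmanSeq {n m : ℕ} (A : ℝ → Matrix (Fin n) (Fin n) ℝ) (B : ℝ → Matrix (Fin n) (Fin m) ℝ) :
    ℕ → ℝ → Matrix (Fin n) (Fin m) ℝ
  | 0 => B
  | i + 1 => fun t => deriv (kalmanSeq A B i) t - A t * kalmanSeq A B i t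

/-- Uniform controllability of `(A, B)`: the controllability Gramians over windows of some fixed
length `s` are `≻ β I` for some `β > 0`. -/
def UniformlyControllable {n m : ℕ} (A : ℝ → Matrix (Fin n) (Fin n) ℝ)
    (B : ℝ → Matrix (Fin n) (Fin m) ℝ) : Prop :=
  ∃ Φ, IsTransitionMatrix A Φ ∧ ∃ s > 0, ∃ β > (0 : ℝ), ∀ t : ℝ,
    ((∫ τ in t..(t + s), Φ t τ * B τ * (B τ)ᵀ * (Φ t τ)ᵀ) -
      β • (1 : Matrix (Fin n) (Fin n) ℝ)).PosDef

/-- The standing assumptions on the dynamics `ẋ = A(t) x + B(t) u`. -/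
structure AdmissibleDynamics {n m : ℕ} (A : ℝ → Matrix (Fin n) (Fin n) ℝ)
    (B : ℝ → Matrix (Fin n) (Fin m) ℝ) : Prop where
  smoothBounded_A : SmoothBounded A
  smoothBounded_B : SmoothBounded B
  injective_B : ∀ t, Function.Injective (fun v : Fin m → ℝ => B t *ᵥ v)
  kalman : ∀ t, Submodule.span ℝ
    {w : Fin n → ℝ | ∃ (i : ℕ) (v : Fin m → ℝ), w = kalmanSeq A B i t *ᵥ v} = ⊤
  uniformlyControllable : UniformlyControllable A B

/-- The coefficients of a quadratic cost `c(t, x, u) = xᵀ Q(t) x + 2 xᵀ S(t) u + uᵀ R(t) u`. -/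
structure QuadCost (n m : ℕ) where
  Q : ℝ → Matrix (Fin n) (Fin n) ℝ
  S : ℝ → Matrix (Fin n) (Fin m) ℝ
  R : ℝ → Matrix (Fin m) (Fin m) ℝ

/-- The value `c(t, x, u)`. -/
def QuadCost.eval {n m : ℕ} (c : QuadCost n m) (t : ℝ) (x : Fin n → ℝ) (u : Fin m → ℝ) : ℝ :=
  x ⬝ᵥ (c.Q t *ᵥ x) + 2 * (x ⬝ᵥ (c.S t *ᵥ u)) + u ⬝ᵥ (c.R t *ᵥ u)

/-- The standing assumptions on the cost, i.e. membership in the class `𝒞_LQ`. -/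
structure QuadCost.Admissible {n m : ℕ} (c : QuadCost n m) : Prop where
  symm_Q : ∀ t, (c.Q t).IsSymm
  symm_R : ∀ t, (c.R t).IsSymm
  smoothBounded_Q : SmoothBounded c.Q
  smoothBounded_S : SmoothBounded c.S
  smoothBounded_R : SmoothBounded c.R
  uniformlyPosDef_R : ∃ α > (0 : ℝ), ∀ t, (c.R t - α • (1 : Matrix (Fin m) (Fin m) ℝ)).PosDef
  nonneg_QS : ∀ t, (c.Q t - c.S t * (c.R t)⁻¹ * (c.S t)ᵀ).PosSemidef

/-- On `[t₀, t₁]`, `x` is an absolutely continuous trajectory of `ẋ = A x + B u` for the square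
integrable control `u` (the differential equation is written in integrated form). -/
structure IsTrajectory {n m : ℕ} (A : ℝ → Matrix (Fin n) (Fin n) ℝ)
    (B : ℝ → Matrix (Fin n) (Fin m) ℝ) (t₀ t₁ : ℝ) (u : ℝ → Fin m → ℝ) (x : ℝ → Fin n → ℝ) :
    Prop where
  memLp_control : MemLp u 2 (volume.restrict (Icc t₀ t₁))
  continuousOn : ContinuousOn x (Icc t₀ t₁)
  integral_eq : ∀ t ∈ Icc t₀ t₁, x t = x t₀ + ∫ τ in t₀..t, (A τ *ᵥ x τ + B τ *ᵥ u τ)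

/-- The integral cost over `[t₀, t₁]`. -/
def QuadCost.total {n m : ℕ} (c : QuadCost n m) (t₀ t₁ : ℝ) (u : ℝ → Fin m → ℝ)
    (x : ℝ → Fin n → ℝ) : ℝ :=
  ∫ t in t₀..t₁, c.eval t (x t) (u t)

/-- On `[t₀, t₁]`, `x` is a minimizing trajectory between its end points `x t₀` and `x t₁`. -/
def IsMinimizing {n m : ℕ} (A : ℝ → Matrix (Fin n) (Fin n) ℝ) (B : ℝ → Matrix (Fin n) (Fin m) ℝ)
    (c : QuadCost n m) (t₀ t₁ : ℝ) (x : ℝ → Fin n → ℝ) : Prop :=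
  ∃ u, IsTrajectory A B t₀ t₁ u x ∧
    ∀ v y, IsTrajectory A B t₀ t₁ v y → y t₀ = x t₀ → y t₁ = x t₁ →
      c.total t₀ t₁ u x ≤ c.total t₀ t₁ v y

/-- The optimal synthesis: all the minimizing trajectories, for all times `t₀ < t₁` and all end
points. An element is a triple `(t₀, t₁, x)`; membership only depends on `x` on `[t₀, t₁]`. -/
def optimalSynthesis {n m : ℕ} (A : ℝ → Matrix (Fin n) (Fin n) ℝ)
    (B : ℝ → Matrix (Fin n) (Fin m) ℝ) (c : QuadCost n m) : Set (ℝ × ℝ × (ℝ → Fin n → ℝ)) :=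
  {p | p.1 < p.2.1 ∧ IsMinimizing A B c p.1 p.2.1 p.2.2}

/-- Two costs are equivalent if they define the same optimal synthesis. -/
def CostEquiv {n m : ℕ} (A : ℝ → Matrix (Fin n) (Fin n) ℝ) (B : ℝ → Matrix (Fin n) (Fin m) ℝ)
    (c c' : QuadCost n m) : Prop :=
  optimalSynthesis A B c = optimalSynthesis A B c'

/-- `P : ℝ → Sym(n)` solves the Riccati differential equation
`Ṗ = -P A - Aᵀ P + (P B + S) R⁻¹ (Bᵀ P + Sᵀ) - Q` on all of `ℝ`. -/
def IsRiccatiSolution {n m : ℕ} (A : ℝ → Matrix (Fin n) (Fin n) ℝ)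
    (B : ℝ → Matrix (Fin n) (Fin m) ℝ) (c : QuadCost n m)
    (P : ℝ → Matrix (Fin n) (Fin n) ℝ) : Prop :=
  (∀ t, (P t).IsSymm) ∧
  ∀ t, HasDerivAt P
    (-(P t * A t) - (A t)ᵀ * P t +
      (P t * B t + c.S t) * (c.R t)⁻¹ * ((B t)ᵀ * P t + (c.S t)ᵀ) - c.Q t) t

/-- The closed-loop matrix `A - B R⁻¹ (Sᵀ + Bᵀ P)`. -/
def closedLoop {n m : ℕ} (A : ℝ → Matrix (Fin n) (Fin n) ℝ) (B : ℝ → Matrix (Fin n) (Fin m) ℝ)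
    (c : QuadCost n m) (P : ℝ → Matrix (Fin n) (Fin n) ℝ) : ℝ → Matrix (Fin n) (Fin n) ℝ :=
  fun t => A t - B t * (c.R t)⁻¹ * ((c.S t)ᵀ + (B t)ᵀ * P t)

/-- `X` is the map `A₊` of the cost `c`: the closed-loop matrix of a solution `P₊` of the Riccati
equation for which this matrix is exponentially stable. -/
def IsAPlus {n m : ℕ} (A : ℝ → Matrix (Fin n) (Fin n) ℝ) (B : ℝ → Matrix (Fin n) (Fin m) ℝ)
    (c : QuadCost n m) (X : ℝ → Matrix (Fin n) (Fin n) ℝ) : Prop :=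
  ∃ P, IsRiccatiSolution A B c P ∧ X = closedLoop A B c P ∧ ExpStable X

/-- `X` is the map `A₋` of the cost `c`: the closed-loop matrix of a solution `P₋` of the Riccati
equation for which this matrix is exponentially anti-stable. -/
def IsAMinus {n m : ℕ} (A : ℝ → Matrix (Fin n) (Fin n) ℝ) (B : ℝ → Matrix (Fin n) (Fin m) ℝ)
    (c : QuadCost n m) (X : ℝ → Matrix (Fin n) (Fin n) ℝ) : Prop :=
  ∃ P, IsRiccatiSolution A B c P ∧ X = closedLoop A B c P ∧ ExpAntiStable X

end

end LQ

namespace LQ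

/-! ### Calculus of matrix-valued maps -/

/-! Closed-loop trajectories of a Riccati solution `P`, with costate `P x`, solve the Hamiltonian
system (`IsRiccatiSolution.isExtremal`). The cost is a nonnegative quadratic form in `(x, u)`, so
every solution of that system is minimizing on every interval (`IsExtremal.isMinimizing`).
Equivalence of the costs makes these trajectories minimizing for `c'` as well, and a Pontryagin
principle on the whole line (`exists_isExtremal`) gives them costates for `c'`. Stack the costates
of a basis of trajectories `Ψ` into a matrix `Λ` and put `P' = Λ Ψ⁻¹`: stationarity says that `P'`
has the same closed loop, and the costate equation becomes the Riccati equation.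

The delicate point is the symmetry of `P'`. The Wronskian `q ⬝ x - p ⬝ y` of two extremals is
constant, so it suffices that it tends to zero at the end of the line where the states vanish. The
Riccati solutions are not assumed bounded and the new costates are not known to be, so decay of the
states alone is not enough. Uniform controllability fills the gap: steering any state to any other
over a window of fixed length costs at most quadratically, uniformly in time. Together with
convexity this bounds `q t ⬝ ξ` by the squares of `‖ξ‖`, `‖y t‖` and `‖y (t + s)‖`
(`exists_abs_dotProduct_costate_le`), so the Wronskian vanishes.

The same orthogonality, applied to two Riccati solutions of one cost, shows that they coincide
(`IsRiccatiSolution.eq_of_tendsto`). The argument is run along a translation-invariant filter, so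
`atTop` gives `A₊` and `atBot` gives `A₋`. -/

theorem hasDerivAt_matrix_iff {n m : ℕ} {M : ℝ → Matrix (Fin n) (Fin m) ℝ}
    {M' : Matrix (Fin n) (Fin m) ℝ} {t : ℝ} :
    HasDerivAt M M' t ↔ ∀ i j, HasDerivAt (fun r => M r i j) (M' i j) t :=
  hasDerivAt_pi.trans (forall_congr' fun _ => hasDerivAt_pi)

theorem hasDerivAt_mul {n m k : ℕ} {M : ℝ → Matrix (Fin n) (Fin m) ℝ}
    {N : ℝ → Matrix (Fin m) (Fin k) ℝ} {M' N'} {t : ℝ}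
    (hM : HasDerivAt M M' t) (hN : HasDerivAt N N' t) :
    HasDerivAt (fun r => M r * N r) (M' * N t + M t * N') t := by
  rw [hasDerivAt_matrix_iff] at *
  intro i j
  simp only [mul_apply, Matrix.add_apply, ← Finset.sum_add_distrib]
  exact HasDerivAt.fun_sum fun l _ => (hM i l).mul (hN l j)

theorem hasDerivAt_mulVec {n m : ℕ} {M : ℝ → Matrix (Fin n) (Fin m) ℝ}
    {x : ℝ → Fin m → ℝ} {M' x'} {t : ℝ}
    (hM : HasDerivAt M M' t) (hx : HasDerivAt x x' t) :
    HasDerivAt (fun r => M r *ᵥ x r) (M' *ᵥ x t + M t *ᵥ x') t := by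
  rw [hasDerivAt_matrix_iff] at hM
  rw [hasDerivAt_pi] at hx ⊢
  intro i
  simp only [mulVec, dotProduct, Pi.add_apply, ← Finset.sum_add_distrib]
  exact HasDerivAt.fun_sum fun l _ => (hM i l).mul (hx l)

theorem hasDerivAt_dotProduct {n : ℕ} {x y : ℝ → Fin n → ℝ} {x' y'} {t : ℝ}
    (hx : HasDerivAt x x' t) (hy : HasDerivAt y y' t) :
    HasDerivAt (fun r => x r ⬝ᵥ y r) (x' ⬝ᵥ y t + x t ⬝ᵥ y') t := by
  rw [hasDerivAt_pi] at hx hy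
  simp only [dotProduct, ← Finset.sum_add_distrib]
  exact HasDerivAt.fun_sum fun l _ => (hx l).mul (hy l)

theorem hasDerivAt_transpose {n m : ℕ} {M : ℝ → Matrix (Fin n) (Fin m) ℝ} {M'} {t : ℝ}
    (hM : HasDerivAt M M' t) : HasDerivAt (fun r => (M r)ᵀ) M'ᵀ t := by
  rw [hasDerivAt_matrix_iff] at *
  exact fun i j => hM j i

/-- The matrix norm here is the entrywise supremum, which is not submultiplicative; hence the
dimension factors in this and the following bounds. -/
theorem norm_mulVec_le {n m : ℕ} (M : Matrix (Fin n) (Fin m) ℝ) (v : Fin m → ℝ) :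
    ‖M *ᵥ v‖ ≤ m * ‖M‖ * ‖v‖ := by
  refine (pi_norm_le_iff_of_nonneg (by positivity)).2 fun i => ?_
  refine (norm_sum_le Finset.univ fun j => M i j * v j).trans ?_
  refine (Finset.sum_le_card_nsmul _ _ (‖M‖ * ‖v‖) fun j _ => ?_).trans (by simp [mul_assoc])
  rw [norm_mul]
  exact mul_le_mul (norm_entry_le_entrywise_sup_norm M) (norm_le_pi_norm v j) (norm_nonneg _)
    (norm_nonneg _)

theorem norm_dotProduct_le {n : ℕ} (v w : Fin n → ℝ) : |v ⬝ᵥ w| ≤ n * ‖v‖ * ‖w‖ := by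
  refine (norm_sum_le Finset.univ fun j => v j * w j).trans ?_
  refine (Finset.sum_le_card_nsmul _ _ (‖v‖ * ‖w‖) fun j _ => ?_).trans (by simp [mul_assoc])
  rw [norm_mul]
  exact mul_le_mul (norm_le_pi_norm v j) (norm_le_pi_norm w j) (norm_nonneg _) (norm_nonneg _)

theorem norm_mul_le' {n m k : ℕ} (M : Matrix (Fin n) (Fin m) ℝ) (N : Matrix (Fin m) (Fin k) ℝ) :
    ‖M * N‖ ≤ m * ‖M‖ * ‖N‖ := by
  refine (Matrix.norm_le_iff (by positivity)).2 fun i j => ?_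
  refine (norm_sum_le Finset.univ fun l => M i l * N l j).trans ?_
  refine (Finset.sum_le_card_nsmul _ _ (‖M‖ * ‖N‖) fun l _ => ?_).trans (by simp [mul_assoc])
  rw [norm_mul]
  exact mul_le_mul (norm_entry_le_entrywise_sup_norm M) (norm_entry_le_entrywise_sup_norm N)
    (norm_nonneg _) (norm_nonneg _)

theorem sq_norm_le_dotProduct_self {n : ℕ} (v : Fin n → ℝ) : ‖v‖ ^ 2 ≤ v ⬝ᵥ v := by
  have h : ‖v‖ ≤ √(v ⬝ᵥ v) := by
    refine (pi_norm_le_iff_of_nonneg (Real.sqrt_nonneg _)).2 fun i => Real.le_sqrt_of_sq_le ?_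
    rw [Real.norm_eq_abs, sq_abs, sq]
    exact Finset.single_le_sum (f := fun i => v i * v i) (fun j _ => mul_self_nonneg _)
      (Finset.mem_univ i)
  exact (Real.le_sqrt (norm_nonneg v) (Finset.sum_nonneg fun i _ => mul_self_nonneg _)).1 h

/-! ### Linear differential equations -/

theorem eq_zero_of_linear_ode_right {n : ℕ} {M : ℝ → Matrix (Fin n) (Fin n) ℝ}
    (hM : Continuous M) {y : ℝ → Fin n → ℝ} {τ : ℝ} (hy : ∀ t, HasDerivAt y (M t *ᵥ y t) t)
    (h0 : y τ = 0) {t : ℝ} (ht : τ ≤ t) : y t = 0 := by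
  obtain ⟨C, hC⟩ := isCompact_Icc.exists_bound_of_continuousOn (s := Icc τ t) hM.continuousOn
  refine eq_zero_of_abs_deriv_le_mul_abs_self_of_eq_zero_right (K := n * C) (a := τ) (b := t)
    (fun r _ => (hy r).continuousAt.continuousWithinAt) (fun r _ => (hy r).hasDerivWithinAt) h0
    (fun r hr => (norm_mulVec_le _ _).trans ?_) t ⟨ht, le_rfl⟩
  gcongr
  exact hC r ⟨hr.1, hr.2.le⟩

theorem eq_zero_of_linear_ode {n : ℕ} {M : ℝ → Matrix (Fin n) (Fin n) ℝ}
    (hM : Continuous M) {y : ℝ → Fin n → ℝ} {τ : ℝ} (hy : ∀ t, HasDerivAt y (M t *ᵥ y t) t)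
    (h0 : y τ = 0) (t : ℝ) : y t = 0 := by
  rcases le_total τ t with ht | ht
  · exact eq_zero_of_linear_ode_right hM hy h0 ht
  · have := eq_zero_of_linear_ode_right (M := fun r => -M (-r)) (y := fun r => y (-r)) (τ := -τ)
      (t := -t) (hM.comp continuous_neg).neg (fun r => ?_) (by simpa using h0) (by linarith)
    · simpa using this
    · have := (hy (-r)).scomp r (hasDerivAt_neg r)
      simp only [neg_smul, one_smul, ← neg_mulVec] at this
      exact this

theorem IsTransitionMatrix.hasDerivAt_mulVec {n : ℕ} {A : ℝ → Matrix (Fin n) (Fin n) ℝ} {Φ}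
    (hΦ : IsTransitionMatrix A Φ) (t τ : ℝ) (ξ : Fin n → ℝ) :
    HasDerivAt (fun r => Φ r τ *ᵥ ξ) (A t *ᵥ (Φ t τ *ᵥ ξ)) t := by
  have := LQ.hasDerivAt_mulVec ((hΦ τ).2 t) (hasDerivAt_const t ξ)
  simpa using this

theorem IsTransitionMatrix.mul_eq {n : ℕ} {A : ℝ → Matrix (Fin n) (Fin n) ℝ} {Φ}
    (hΦ : IsTransitionMatrix A Φ) (hA : Continuous A) (t τ σ : ℝ) :
    Φ t τ * Φ τ σ = Φ t σ := by
  rw [← sub_eq_zero]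
  refine ext_of_mulVec_single fun i => ?_
  have := eq_zero_of_linear_ode hA (τ := τ)
    (y := fun r => (Φ r τ *ᵥ (Φ τ σ *ᵥ Pi.single i 1)) - Φ r σ *ᵥ Pi.single i 1)
    (fun r => by
      rw [mulVec_sub]
      exact (hΦ.hasDerivAt_mulVec r τ _).sub (hΦ.hasDerivAt_mulVec r σ _))
    (by simp [(hΦ τ).1]) t
  simpa only [sub_mulVec, zero_mulVec, ← mulVec_mulVec] using this

theorem IsTransitionMatrix.mul_swap {n : ℕ} {A : ℝ → Matrix (Fin n) (Fin n) ℝ} {Φ}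
    (hΦ : IsTransitionMatrix A Φ) (hA : Continuous A) (t τ : ℝ) : Φ t τ * Φ τ t = 1 := by
  rw [hΦ.mul_eq hA, (hΦ t).1]

theorem differentiableAt_det {n : ℕ} {M : ℝ → Matrix (Fin n) (Fin n) ℝ} {t : ℝ}
    (hM : ∀ i j, DifferentiableAt ℝ (fun r => M r i j) t) :
    DifferentiableAt ℝ (fun r => (M r).det) t := by
  simp only [det_apply]
  refine DifferentiableAt.fun_sum fun σ _ => DifferentiableAt.const_smul ?_ _
  exact DifferentiableAt.fun_finsetProd fun i _ => hM _ _

theorem differentiableAt_inv {n : ℕ} {M : ℝ → Matrix (Fin n) (Fin n) ℝ} {t : ℝ}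
    (hM : DifferentiableAt ℝ M t) (h : IsUnit (M t).det) :
    DifferentiableAt ℝ (fun r => (M r)⁻¹) t := by
  have hM' : ∀ i j, DifferentiableAt ℝ (fun r => M r i j) t := fun i j =>
    (hasDerivAt_matrix_iff.1 hM.hasDerivAt i j).differentiableAt
  refine differentiableAt_pi.2 fun i => differentiableAt_pi.2 fun j => ?_
  simp only [inv_def, Ring.inverse_eq_inv', Matrix.smul_apply, smul_eq_mul, adjugate_apply]
  refine ((differentiableAt_det hM').inv h.ne_zero).mul (differentiableAt_det fun k l => ?_)
  by_cases hk : k = j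
  · subst hk
    simp
  · simpa [updateRow_ne hk] using hM' k l

/-- `Φ τ r` is the inverse of `Φ r τ`, hence differentiable in `r`; differentiating the product of
the two, which is constantly `1`, gives the derivative. -/
theorem IsTransitionMatrix.hasDerivAt_right {n : ℕ} {A : ℝ → Matrix (Fin n) (Fin n) ℝ} {Φ}
    (hΦ : IsTransitionMatrix A Φ) (hA : Continuous A) (τ t : ℝ) :
    HasDerivAt (fun r => Φ τ r) (-(Φ τ t * A t)) t := by
  have hinv : (fun r => Φ τ r) = fun r => (Φ r τ)⁻¹ := by
    funext r
    exact (inv_eq_left_inv (hΦ.mul_swap hA τ r)).symm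
  have hu : IsUnit (Φ t τ).det := isUnit_det_of_left_inverse (hΦ.mul_swap hA τ t)
  have hd : DifferentiableAt ℝ (fun r => Φ τ r) t := by
    rw [hinv]
    exact differentiableAt_inv ((hΦ τ).2 t).differentiableAt hu
  have h1 := hasDerivAt_mul hd.hasDerivAt ((hΦ τ).2 t)
  simp only [hΦ.mul_swap hA] at h1
  have h2 := h1.unique (hasDerivAt_const t _)
  rw [← Matrix.mul_assoc, ← Matrix.add_mul] at h2
  have h3 : deriv (fun r => Φ τ r) t + Φ τ t * A t = 0 := by
    have := congrArg (· * Φ τ t) h2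
    simp only [Matrix.mul_assoc, hΦ.mul_swap hA, Matrix.mul_one, Matrix.zero_mul] at this
    exact this
  rw [← eq_neg_of_add_eq_zero_left h3]
  exact hd.hasDerivAt

theorem IsTransitionMatrix.continuous_left {n : ℕ} {A : ℝ → Matrix (Fin n) (Fin n) ℝ} {Φ}
    (hΦ : IsTransitionMatrix A Φ) (τ : ℝ) : Continuous fun r => Φ r τ :=
  continuous_iff_continuousAt.2 fun t => ((hΦ τ).2 t).continuousAt

theorem IsTransitionMatrix.continuous_right {n : ℕ} {A : ℝ → Matrix (Fin n) (Fin n) ℝ} {Φ}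
    (hΦ : IsTransitionMatrix A Φ) (hA : Continuous A) (τ : ℝ) : Continuous fun r => Φ τ r :=
  continuous_iff_continuousAt.2 fun t => (hΦ.hasDerivAt_right hA τ t).continuousAt

/-- A uniform bound of the backward transition matrix of a bounded `A` over windows. -/
theorem IsTransitionMatrix.norm_right_le {n : ℕ} {A : ℝ → Matrix (Fin n) (Fin n) ℝ} {Φ}
    (hΦ : IsTransitionMatrix A Φ) (hA : Continuous A) {C : ℝ} (hC : ∀ t, ‖A t‖ ≤ C) (s : ℝ) :
    ∀ t, ∀ τ ∈ Icc t (t + s), ‖Φ t τ‖ ≤ Real.exp (n * C * s) := by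
  intro t τ hτ
  have hC0 : 0 ≤ C := (norm_nonneg _).trans (hC 0)
  have h := norm_le_gronwallBound_of_norm_deriv_right_le (f := fun r => Φ t r) (δ := 1)
    (K := n * C) (ε := 0) (a := t) (b := t + s) (hΦ.continuous_right hA t).continuousOn
    (fun r _ => (hΦ.hasDerivAt_right hA t r).hasDerivWithinAt)
    (by
      rw [(hΦ t).1]
      refine (Matrix.norm_le_iff zero_le_one).2 fun i j => ?_
      rw [one_apply]; split_ifs <;> simp)
    (fun r _ => by
      rw [norm_neg, add_zero]
      refine (norm_mul_le' _ _).trans ?_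
      have := hC r
      calc (n : ℝ) * ‖Φ t r‖ * ‖A r‖ ≤ n * ‖Φ t r‖ * C := by gcongr
        _ = _ := by ring) τ hτ
  rw [gronwallBound_ε0, one_mul] at h
  refine h.trans (Real.exp_le_exp.2 ?_)
  have := hτ.2
  gcongr
  linarith

theorem IsTransitionMatrix.norm_left_le {n : ℕ} {A : ℝ → Matrix (Fin n) (Fin n) ℝ} {Φ}
    (hΦ : IsTransitionMatrix A Φ) {C : ℝ} (hC : ∀ t, ‖A t‖ ≤ C) (s : ℝ) :
    ∀ t, ∀ τ ∈ Icc t (t + s), ‖Φ τ t‖ ≤ Real.exp (n * C * s) := by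
  intro t τ hτ
  have hC0 : 0 ≤ C := (norm_nonneg _).trans (hC 0)
  have h := norm_le_gronwallBound_of_norm_deriv_right_le (f := fun r => Φ r t) (δ := 1)
    (K := n * C) (ε := 0) (a := t) (b := t + s) (hΦ.continuous_left t).continuousOn
    (fun r _ => ((hΦ t).2 r).hasDerivWithinAt)
    (by
      rw [(hΦ t).1]
      refine (Matrix.norm_le_iff zero_le_one).2 fun i j => ?_
      rw [one_apply]; split_ifs <;> simp)
    (fun r _ => by
      rw [add_zero]
      refine (norm_mul_le' _ _).trans ?_
      have := hC r
      gcongr) τ hτ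
  rw [gronwallBound_ε0, one_mul] at h
  refine h.trans (Real.exp_le_exp.2 ?_)
  have := hτ.2
  gcongr
  linarith

/-! ### Algebra of quadratic costs -/

/-- The symmetric bilinear form that polarizes `QuadCost.eval`. -/
def QuadCost.bil {n m : ℕ} (c : QuadCost n m) (t : ℝ) (x : Fin n → ℝ) (u : Fin m → ℝ)
    (z : Fin n → ℝ) (w : Fin m → ℝ) : ℝ :=
  z ⬝ᵥ (c.Q t *ᵥ x + c.S t *ᵥ u) + w ⬝ᵥ ((c.S t)ᵀ *ᵥ x + c.R t *ᵥ u)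

theorem dotProduct_transpose_mulVec {n m : ℕ} (M : Matrix (Fin n) (Fin m) ℝ) (x : Fin n → ℝ)
    (u : Fin m → ℝ) : u ⬝ᵥ (Mᵀ *ᵥ x) = x ⬝ᵥ (M *ᵥ u) := by
  rw [mulVec_transpose, dotProduct_comm, ← dotProduct_mulVec]

theorem dotProduct_mulVec_comm_of_isSymm {n : ℕ} {M : Matrix (Fin n) (Fin n) ℝ} (hM : M.IsSymm)
    (x y : Fin n → ℝ) : x ⬝ᵥ (M *ᵥ y) = y ⬝ᵥ (M *ᵥ x) := by
  conv_lhs => rw [← hM.eq, dotProduct_transpose_mulVec]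

theorem QuadCost.bil_self {n m : ℕ} (c : QuadCost n m) (t : ℝ) (x : Fin n → ℝ) (u : Fin m → ℝ) :
    c.bil t x u x u = c.eval t x u := by
  simp only [bil, eval, dotProduct_add, dotProduct_transpose_mulVec]
  ring

theorem QuadCost.Admissible.eval_add_smul {n m : ℕ} {c : QuadCost n m} (hc : c.Admissible)
    (t : ℝ) (x : Fin n → ℝ) (u : Fin m → ℝ) (z : Fin n → ℝ) (w : Fin m → ℝ) (ε : ℝ) :
    c.eval t (x + ε • z) (u + ε • w) =
      c.eval t x u + 2 * ε * c.bil t x u z w + ε ^ 2 * c.eval t z w := by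
  simp only [bil, eval, dotProduct_add, add_dotProduct, mulVec_add, mulVec_smul, smul_dotProduct,
    dotProduct_smul, smul_eq_mul, dotProduct_transpose_mulVec,
    dotProduct_mulVec_comm_of_isSymm (hc.symm_Q t) x z,
    dotProduct_mulVec_comm_of_isSymm (hc.symm_R t) u w]
  ring

theorem QuadCost.Admissible.posDef_R {n m : ℕ} {c : QuadCost n m} (hc : c.Admissible) (t : ℝ) :
    (c.R t).PosDef := by
  obtain ⟨α, hα, h⟩ := hc.uniformlyPosDef_R
  have := (h t).add_posSemidef ((PosSemidef.one (n := Fin m) (R := ℝ)).smul hα.le)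
  simpa using this

theorem QuadCost.Admissible.isUnit_det_R {n m : ℕ} {c : QuadCost n m} (hc : c.Admissible)
    (t : ℝ) : IsUnit (c.R t).det :=
  (hc.posDef_R t).det_pos.ne'.isUnit

/-- `Q - S R⁻¹ Sᵀ` is the Schur complement of `R` in the block matrix of the form. -/
theorem QuadCost.Admissible.eval_nonneg {n m : ℕ} {c : QuadCost n m} (hc : c.Admissible)
    (t : ℝ) (x : Fin n → ℝ) (u : Fin m → ℝ) : 0 ≤ c.eval t x u := by
  have hR := hc.posDef_R t
  let _ := (c.R t).invertibleOfIsUnitDet (hc.isUnit_det_R t)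
  have h := (PosDef.fromBlocks₂₂ (c.Q t) (c.S t) hR).2 (by simpa using hc.nonneg_QS t)
  have := h.dotProduct_mulVec_nonneg (Sum.elim x u)
  simp only [star_trivial, fromBlocks_mulVec, sumElim_dotProduct_sumElim, dotProduct_add,
    Sum.elim_comp_inl, Sum.elim_comp_inr, conjTranspose_eq_transpose_of_trivial,
    dotProduct_transpose_mulVec] at this
  simp only [eval]
  linarith

/-- Nonnegativity of the form at the difference of the two points. This is the only use of
convexity, and no strictness is needed. -/
theorem QuadCost.Admissible.two_mul_bil_le {n m : ℕ} {c : QuadCost n m} (hc : c.Admissible)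
    (t : ℝ) (x : Fin n → ℝ) (u : Fin m → ℝ) (z : Fin n → ℝ) (w : Fin m → ℝ) :
    2 * c.bil t x u z w ≤ c.eval t x u + c.eval t z w := by
  have h := hc.eval_nonneg t (x + (-1 : ℝ) • z) (u + (-1 : ℝ) • w)
  rw [hc.eval_add_smul] at h
  linarith

theorem QuadCost.Admissible.exists_eval_le {n m : ℕ} {c : QuadCost n m} (hc : c.Admissible) :
    ∃ C, 0 ≤ C ∧ ∀ t x u, c.eval t x u ≤ C * (‖x‖ + ‖u‖) ^ 2 := by
  obtain ⟨CQ, hQ⟩ := hc.smoothBounded_Q.2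
  obtain ⟨CS, hS⟩ := hc.smoothBounded_S.2
  obtain ⟨CR, hR⟩ := hc.smoothBounded_R.2
  have hQ0 : 0 ≤ CQ := (norm_nonneg _).trans (hQ 0)
  have hS0 : 0 ≤ CS := (norm_nonneg _).trans (hS 0)
  have hR0 : 0 ≤ CR := (norm_nonneg _).trans (hR 0)
  have key : ∀ {k l : ℕ} (M : Matrix (Fin k) (Fin l) ℝ) (C : ℝ) (v : Fin k → ℝ) (w : Fin l → ℝ)
      (r : ℝ), ‖M‖ ≤ C → 0 ≤ C → ‖v‖ ≤ r → ‖w‖ ≤ r → v ⬝ᵥ (M *ᵥ w) ≤ (k * l * C) * r ^ 2 := by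
    intro k l M C v w r hM hC hv hw
    have hr : 0 ≤ r := (norm_nonneg _).trans hv
    calc v ⬝ᵥ (M *ᵥ w) ≤ k * ‖v‖ * ‖M *ᵥ w‖ := (le_abs_self _).trans (norm_dotProduct_le _ _)
      _ ≤ k * r * (l * C * r) := by
        refine mul_le_mul (by gcongr) ((norm_mulVec_le _ _).trans (by gcongr)) (norm_nonneg _)
          (by positivity)
      _ = _ := by ring
  refine ⟨n * n * CQ + 2 * (n * m * CS) + m * m * CR, by positivity, fun t x u => ?_⟩
  have hx : ‖x‖ ≤ ‖x‖ + ‖u‖ := le_add_of_nonneg_right (norm_nonneg _)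
  have hu : ‖u‖ ≤ ‖x‖ + ‖u‖ := le_add_of_nonneg_left (norm_nonneg _)
  have h1 := key _ _ x x _ (hQ t) hQ0 hx hx
  have h2 := key _ _ x u _ (hS t) hS0 hx hu
  have h3 := key _ _ u u _ (hR t) hR0 hu hu
  simp only [eval]
  linarith

/-! ### Extremals and the sufficient condition -/

/-- `x` with the control `u` and the costate `p` satisfies the Hamiltonian system of the cost `c`
on all of `ℝ`. -/
structure IsExtremal {n m : ℕ} (A : ℝ → Matrix (Fin n) (Fin n) ℝ)
    (B : ℝ → Matrix (Fin n) (Fin m) ℝ) (c : QuadCost n m) (x : ℝ → Fin n → ℝ)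
    (u : ℝ → Fin m → ℝ) (p : ℝ → Fin n → ℝ) : Prop where
  continuous_control : Continuous u
  hasDerivAt_state : ∀ t, HasDerivAt x (A t *ᵥ x t + B t *ᵥ u t) t
  hasDerivAt_costate : ∀ t,
    HasDerivAt p (-((A t)ᵀ *ᵥ p t) - (c.Q t *ᵥ x t + c.S t *ᵥ u t)) t
  stationary : ∀ t, (B t)ᵀ *ᵥ p t + ((c.S t)ᵀ *ᵥ x t + c.R t *ᵥ u t) = 0

/-- Integration by parts with `z` merely absolutely continuous, as competitors have only `L²`
controls. -/
theorem integral_deriv_mul_add_mul {p p' z g : ℝ → ℝ} {a b : ℝ} (hab : a ≤ b)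
    (hp : ∀ t, HasDerivAt p (p' t) t) (hp' : Continuous p') (hg : IntervalIntegrable g volume a b)
    (hz : ∀ t ∈ Icc a b, z t = z a + ∫ τ in a..t, g τ) :
    IntervalIntegrable (fun t => p' t * z t + p t * g t) volume a b ∧
      ∫ t in a..b, (p' t * z t + p t * g t) = p b * z b - p a * z a := by
  set Z : ℝ → ℝ := fun t => z a + ∫ τ in a..t, g τ with hZ
  have hderiv : deriv p = p' := funext fun t => (hp t).deriv
  have hpac : AbsolutelyContinuousOnInterval p a b :=
    ContDiffOn.absolutelyContinuousOnInterval (ContDiff.contDiffOn (contDiff_one_iff_deriv.2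
      ⟨fun t => (hp t).differentiableAt, by rwa [hderiv]⟩))
  have hint := hg.absolutelyContinuousOnInterval_intervalIntegral (c := a) (by simp)
  have hZac : AbsolutelyContinuousOnInterval Z a b := by
    refine AbsolutelyContinuousOnInterval.add ?_ hint
    exact ContDiffOn.absolutelyContinuousOnInterval contDiff_const.contDiffOn
  have hZd : ∀ᵐ t, t ∈ uIcc a b → deriv Z t = g t := by
    filter_upwards [hg.ae_hasDerivAt_integral] with t ht hmem
    exact ((ht hmem a (by simp)).const_add (z a)).deriv
  have hzc : ContinuousOn z (uIcc a b) := by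
    refine hZac.continuousOn.congr fun t ht => ?_
    rw [uIcc_of_le hab] at ht
    exact hz t ht
  have hpc : Continuous p := continuous_iff_continuousAt.2 fun t => (hp t).continuousAt
  refine ⟨?_, ?_⟩
  · exact (hp'.continuousOn.mul hzc).intervalIntegrable.add
      (hg.continuousOn_mul hpc.continuousOn)
  · have h := hpac.integral_deriv_mul_eq_sub hZac
    rw [hz b ⟨hab, le_rfl⟩]
    have hZa : Z a = z a := by simp [hZ]
    rw [hZa] at h
    rw [← h]
    refine intervalIntegral.integral_congr_ae ?_
    filter_upwards [hZd] with t ht hmem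
    have hmem' := uIoc_subset_uIcc hmem
    rw [ht hmem', hderiv, hz t (by rwa [uIcc_of_le hab] at hmem')]

theorem integral_deriv_dotProduct_add_dotProduct {n : ℕ} {p p' z g : ℝ → Fin n → ℝ} {a b : ℝ}
    (hab : a ≤ b)
    (hp : ∀ t, HasDerivAt p (p' t) t) (hp' : Continuous p') (hg : IntervalIntegrable g volume a b)
    (hz : ∀ t ∈ Icc a b, z t = z a + ∫ τ in a..t, g τ) :
    IntervalIntegrable (fun t => p' t ⬝ᵥ z t + p t ⬝ᵥ g t) volume a b ∧
      ∫ t in a..b, (p' t ⬝ᵥ z t + p t ⬝ᵥ g t) = p b ⬝ᵥ z b - p a ⬝ᵥ z a := by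
  have hgi : ∀ i, IntervalIntegrable (fun t => g t i) volume a b := fun i =>
    ⟨hg.1.eval i, hg.2.eval i⟩
  have h := fun i => integral_deriv_mul_add_mul (p := fun t => p t i) (p' := fun t => p' t i)
    (z := fun t => z t i) (g := fun t => g t i) hab (fun t => hasDerivAt_pi.1 (hp t) i)
    (by fun_prop) (hgi i) (fun t ht => by
      have hgt : IntervalIntegrable g volume a t :=
        hg.mono_set (by rw [uIcc_of_le hab, uIcc_of_le ht.1]; exact Icc_subset_Icc_right ht.2)
      have := (ContinuousLinearMap.proj (R := ℝ) (φ := fun _ : Fin n => ℝ) i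
        ).intervalIntegral_comp_comm hgt
      simp only [ContinuousLinearMap.proj_apply] at this
      rw [this]
      exact congrFun (hz t ht) i)
  simp only [dotProduct, ← Finset.sum_add_distrib, ← Finset.sum_sub_distrib]
  refine ⟨by simpa only [Finset.sum_fn] using IntervalIntegrable.sum _ fun i _ => (h i).1, ?_⟩
  rw [intervalIntegral.integral_finsetSum fun i _ => (h i).1]
  exact Finset.sum_congr rfl fun i _ => (h i).2

theorem continuousOn_mulVec {n m : ℕ} {M : ℝ → Matrix (Fin n) (Fin m) ℝ} {z : ℝ → Fin m → ℝ}
    {s : Set ℝ} (hM : Continuous M) (hz : ContinuousOn z s) :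
    ContinuousOn (fun t => M t *ᵥ z t) s := by
  rw [continuousOn_iff_continuous_domRestrict] at hz ⊢
  exact (hM.comp continuous_subtype_val).matrix_mulVec hz

theorem continuousOn_dotProduct {n : ℕ} {y z : ℝ → Fin n → ℝ}
    {s : Set ℝ} (hy : ContinuousOn y s) (hz : ContinuousOn z s) :
    ContinuousOn (fun t => y t ⬝ᵥ z t) s := by
  rw [continuousOn_iff_continuous_domRestrict] at hy hz ⊢
  exact hy.dotProduct hz

theorem IsTrajectory.intervalIntegrable {n m : ℕ} {A : ℝ → Matrix (Fin n) (Fin n) ℝ}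
    {B : ℝ → Matrix (Fin n) (Fin m) ℝ} {a b : ℝ} {w : ℝ → Fin m → ℝ} {z : ℝ → Fin n → ℝ}
    (hz : IsTrajectory A B a b w z) (hab : a ≤ b) (hA : Continuous A) (hB : Continuous B) :
    IntervalIntegrable (fun t => A t *ᵥ z t + B t *ᵥ w t) volume a b := by
  have hw : IntegrableOn w (Icc a b) := hz.memLp_control.integrable (by norm_num)
  refine IntervalIntegrable.add ?_ ?_
  · refine ContinuousOn.intervalIntegrable_of_Icc hab ?_
    exact continuousOn_mulVec hA hz.continuousOn
  · rw [intervalIntegrable_iff_integrableOn_Icc_of_le hab]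
    refine Integrable.of_eval fun i => ?_
    simp only [mulVec, dotProduct]
    refine integrable_finsetSum _ fun j _ => ?_
    exact IntegrableOn.continuousOn_mul (K := Icc a b) (hB.matrix_elem i j).continuousOn
      (hw.eval j) isCompact_Icc

/-- The costate equation and stationarity make the polarized cost equal to minus the derivative of
`p ⬝ z`, for any trajectory `z`. -/
theorem IsExtremal.integral_bil {n m : ℕ} {A : ℝ → Matrix (Fin n) (Fin n) ℝ}
    {B : ℝ → Matrix (Fin n) (Fin m) ℝ} {c : QuadCost n m} {x u p}
    (hx : IsExtremal A B c x u p) (hc : c.Admissible) (hA : Continuous A) (hB : Continuous B)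
    {a b : ℝ} (hab : a ≤ b)
    {w z} (hz : IsTrajectory A B a b w z) :
    IntervalIntegrable (fun t => c.bil t (x t) (u t) (z t) (w t)) volume a b ∧
      ∫ t in a..b, c.bil t (x t) (u t) (z t) (w t) = p a ⬝ᵥ z a - p b ⬝ᵥ z b := by
  have hQ := hc.smoothBounded_Q.1.continuous
  have hS := hc.smoothBounded_S.1.continuous
  have hu := hx.continuous_control
  have hxc : Continuous x :=
    continuous_iff_continuousAt.2 fun t => (hx.hasDerivAt_state t).continuousAt
  have hpc : Continuous p :=
    continuous_iff_continuousAt.2 fun t => (hx.hasDerivAt_costate t).continuousAt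
  have h := integral_deriv_dotProduct_add_dotProduct hab hx.hasDerivAt_costate
    (((hA.matrix_transpose.matrix_mulVec hpc).neg).sub
      ((hQ.matrix_mulVec hxc).add (hS.matrix_mulVec hu)))
    (hz.intervalIntegrable hab hA hB) hz.integral_eq
  have heq : ∀ t, (-((A t)ᵀ *ᵥ p t) - (c.Q t *ᵥ x t + c.S t *ᵥ u t)) ⬝ᵥ z t +
      p t ⬝ᵥ (A t *ᵥ z t + B t *ᵥ w t) = -c.bil t (x t) (u t) (z t) (w t) := by
    intro t
    have h1 : (c.S t)ᵀ *ᵥ x t + c.R t *ᵥ u t = -((B t)ᵀ *ᵥ p t) :=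
      eq_neg_of_add_eq_zero_right (hx.stationary t)
    rw [QuadCost.bil, h1, dotProduct_neg, dotProduct_transpose_mulVec, sub_dotProduct,
      neg_dotProduct, dotProduct_comm _ (z t), dotProduct_transpose_mulVec, dotProduct_add,
      dotProduct_comm _ (z t)]
    ring
  simp only [heq] at h
  refine ⟨by simpa only [Pi.neg_def, neg_neg] using h.1.neg, ?_⟩
  have := h.2
  rw [intervalIntegral.integral_neg] at this
  linarith

theorem IsTrajectory.intervalIntegrable_eval {n m : ℕ} {A : ℝ → Matrix (Fin n) (Fin n) ℝ}
    {B : ℝ → Matrix (Fin n) (Fin m) ℝ} {c : QuadCost n m} (hc : c.Admissible) {a b : ℝ}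
    (hab : a ≤ b) {w z} (hz : IsTrajectory A B a b w z) :
    IntervalIntegrable (fun t => c.eval t (z t) (w t)) volume a b := by
  have hQ := hc.smoothBounded_Q.1.continuous
  have hS := hc.smoothBounded_S.1.continuous
  have hR := hc.smoothBounded_R.1.continuous
  have hw2 : ∀ j, MemLp (fun t => w t j) 2 (volume.restrict (Icc a b)) :=
    fun j => hz.memLp_control.eval j
  have hw : ∀ j, IntegrableOn (fun t => w t j) (Icc a b) := fun j =>
    (hw2 j).integrable (by norm_num)
  have hzi : ∀ i, ContinuousOn (fun t => z t i) (Icc a b) := fun i =>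
    (continuous_apply i).comp_continuousOn hz.continuousOn
  rw [intervalIntegrable_iff_integrableOn_Icc_of_le hab]
  refine (IntegrableOn.add ?_ ?_).add ?_
  · exact (continuousOn_dotProduct hz.continuousOn (continuousOn_mulVec hQ hz.continuousOn)
      ).integrableOn_compact isCompact_Icc
  · refine Integrable.const_mul ?_ 2
    refine integrable_finsetSum _ fun i _ => ?_
    refine IntegrableOn.continuousOn_mul (hzi i) ?_ isCompact_Icc
    simp only [mulVec, dotProduct]
    refine integrable_finsetSum _ fun j _ => ?_
    exact IntegrableOn.continuousOn_mul (hS.matrix_elem i j).continuousOn (hw j) isCompact_Icc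
  · refine integrable_finsetSum _ fun i _ => ?_
    simp only [mulVec, dotProduct, Finset.mul_sum]
    refine integrable_finsetSum _ fun j _ => ?_
    have : IntegrableOn (fun t => w t i * w t j) (Icc a b) := (hw2 i).integrable_mul (hw2 j)
    have := IntegrableOn.continuousOn_mul (hR.matrix_elem i j).continuousOn this isCompact_Icc
    refine this.congr_fun (fun t _ => ?_) measurableSet_Icc
    simp only
    ring

theorem IsTrajectory.of_hasDerivAt {n m : ℕ} {A : ℝ → Matrix (Fin n) (Fin n) ℝ}
    {B : ℝ → Matrix (Fin n) (Fin m) ℝ} (hA : Continuous A) (hB : Continuous B)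
    {w : ℝ → Fin m → ℝ} {z : ℝ → Fin n → ℝ} (hw : Continuous w)
    (hz : ∀ t, HasDerivAt z (A t *ᵥ z t + B t *ᵥ w t) t) (a b : ℝ) :
    IsTrajectory A B a b w z := by
  have hzc : Continuous z := continuous_iff_continuousAt.2 fun t => (hz t).continuousAt
  refine ⟨?_, hzc.continuousOn, fun t _ => ?_⟩
  · obtain ⟨C, hC⟩ := isCompact_Icc.exists_bound_of_continuousOn (s := Icc a b) hw.continuousOn
    exact MemLp.of_bound hw.aestronglyMeasurable C
      ((ae_restrict_iff' measurableSet_Icc).2 (Filter.Eventually.of_forall hC))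
  · rw [intervalIntegral.integral_eq_sub_of_hasDerivAt (fun r _ => hz r)
      (((hA.matrix_mulVec hzc).add (hB.matrix_mulVec hw)).intervalIntegrable _ _)]
    simp

theorem IsExtremal.isTrajectory {n m : ℕ} {A : ℝ → Matrix (Fin n) (Fin n) ℝ}
    {B : ℝ → Matrix (Fin n) (Fin m) ℝ} {c : QuadCost n m} {x u p}
    (hx : IsExtremal A B c x u p) (hA : Continuous A) (hB : Continuous B) (a b : ℝ) :
    IsTrajectory A B a b u x :=
  .of_hasDerivAt hA hB hx.continuous_control hx.hasDerivAt_state a b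

/-- The end points of `z` are left free: equal end points give optimality, while `z` steered to zero
later bounds the costate. -/
theorem IsExtremal.two_mul_le {n m : ℕ} {A : ℝ → Matrix (Fin n) (Fin n) ℝ}
    {B : ℝ → Matrix (Fin n) (Fin m) ℝ} {c : QuadCost n m} {x u p}
    (hx : IsExtremal A B c x u p) (hc : c.Admissible) (hA : Continuous A) (hB : Continuous B)
    {a b : ℝ} (hab : a ≤ b) {w z} (hz : IsTrajectory A B a b w z) :
    2 * (p a ⬝ᵥ z a - p b ⬝ᵥ z b) ≤ c.total a b u x + c.total a b w z := by
  obtain ⟨h1, h2⟩ := hx.integral_bil hc hA hB hab hz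
  have hxi := (hx.isTrajectory hA hB a b).intervalIntegrable_eval hc hab
  have hzi := hz.intervalIntegrable_eval hc hab
  rw [← h2, QuadCost.total, QuadCost.total, ← intervalIntegral.integral_const_mul,
    ← intervalIntegral.integral_add hxi hzi]
  exact intervalIntegral.integral_mono_on hab (h1.const_mul 2) (hxi.add hzi)
    fun t _ => hc.two_mul_bil_le t _ _ _ _

theorem IsExtremal.total_eq {n m : ℕ} {A : ℝ → Matrix (Fin n) (Fin n) ℝ}
    {B : ℝ → Matrix (Fin n) (Fin m) ℝ} {c : QuadCost n m} {x u p}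
    (hx : IsExtremal A B c x u p) (hc : c.Admissible) (hA : Continuous A) (hB : Continuous B)
    {a b : ℝ} (hab : a ≤ b) :
    c.total a b u x = p a ⬝ᵥ x a - p b ⬝ᵥ x b := by
  rw [← (hx.integral_bil hc hA hB hab (hx.isTrajectory hA hB a b)).2]
  simp only [QuadCost.bil_self, QuadCost.total]

theorem IsExtremal.total_le {n m : ℕ} {A : ℝ → Matrix (Fin n) (Fin n) ℝ}
    {B : ℝ → Matrix (Fin n) (Fin m) ℝ} {c : QuadCost n m} {x u p}
    (hx : IsExtremal A B c x u p) (hc : c.Admissible) (hA : Continuous A) (hB : Continuous B)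
    {a b : ℝ} (hab : a ≤ b) {w z} (hz : IsTrajectory A B a b w z) (ha : z a = x a)
    (hb : z b = x b) : c.total a b u x ≤ c.total a b w z := by
  have h1 := hx.two_mul_le hc hA hB hab hz
  have h2 := hx.total_eq hc hA hB hab
  rw [ha, hb] at h1
  linarith

theorem IsExtremal.isMinimizing {n m : ℕ} {A : ℝ → Matrix (Fin n) (Fin n) ℝ}
    {B : ℝ → Matrix (Fin n) (Fin m) ℝ} {c : QuadCost n m} {x u p}
    (hx : IsExtremal A B c x u p) (hc : c.Admissible) (hA : Continuous A) (hB : Continuous B)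
    {a b : ℝ} (hab : a ≤ b) : IsMinimizing A B c a b x :=
  ⟨u, hx.isTrajectory hA hB a b, fun _ _ hz ha hb => hx.total_le hc hA hB hab hz ha hb⟩

/-! ### Variation of constants -/

/-- `-Aᵀ` is the homogeneous part of the costate equation, which is then solved by variation of
constants. -/
theorem IsTransitionMatrix.adjoint {n : ℕ} {A : ℝ → Matrix (Fin n) (Fin n) ℝ} {Φ}
    (hΦ : IsTransitionMatrix A Φ) (hA : Continuous A) :
    IsTransitionMatrix (fun t => -(A t)ᵀ) (fun t τ => (Φ τ t)ᵀ) := by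
  refine fun τ => ⟨by simp [(hΦ τ).1], fun t => ?_⟩
  have := hasDerivAt_transpose (hΦ.hasDerivAt_right hA τ t)
  rw [transpose_neg, transpose_mul, ← Matrix.neg_mul] at this
  exact this

theorem IsTransitionMatrix.hasDerivAt_variation {n : ℕ} {A : ℝ → Matrix (Fin n) (Fin n) ℝ} {Φ}
    (hΦ : IsTransitionMatrix A Φ) (hA : Continuous A) {g : ℝ → Fin n → ℝ} (hg : Continuous g)
    (τ a t : ℝ) (ξ : Fin n → ℝ) :
    HasDerivAt (fun r => Φ r τ *ᵥ (ξ + ∫ σ in a..r, Φ τ σ *ᵥ g σ))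
      (A t *ᵥ (Φ t τ *ᵥ (ξ + ∫ σ in a..t, Φ τ σ *ᵥ g σ)) + g t) t := by
  have hc : Continuous fun σ => Φ τ σ *ᵥ g σ := (hΦ.continuous_right hA τ).matrix_mulVec hg
  have h1 := (intervalIntegral.integral_hasDerivAt_right (hc.intervalIntegrable a t)
    hc.stronglyMeasurable.stronglyMeasurableAtFilter hc.continuousAt).const_add ξ
  have := LQ.hasDerivAt_mulVec ((hΦ τ).2 t) h1
  rw [mulVec_mulVec _ (Φ t τ) (Φ τ t), hΦ.mul_swap hA, one_mulVec, ← mulVec_mulVec] at this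
  exact this

/-! ### Gramians -/

theorem integral_mulVec {n m : ℕ} {M : ℝ → Matrix (Fin n) (Fin m) ℝ} (hM : Continuous M)
    (a b : ℝ) (η : Fin m → ℝ) :
    (∫ τ in a..b, M τ) *ᵥ η = ∫ τ in a..b, M τ *ᵥ η :=
  ((LinearMap.toContinuousLinearMap ((mulVecBilin ℝ ℝ).flip η :
    Matrix (Fin n) (Fin m) ℝ →ₗ[ℝ] (Fin n → ℝ))).intervalIntegral_comp_comm
      (hM.intervalIntegrable a b)).symm

theorem dotProduct_integral {n : ℕ} (η : Fin n → ℝ) {g : ℝ → Fin n → ℝ}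
    (hg : Continuous g) (a b : ℝ) :
    η ⬝ᵥ (∫ τ in a..b, g τ) = ∫ τ in a..b, η ⬝ᵥ g τ :=
  ((LinearMap.toContinuousLinearMap (dotProductBilin ℝ ℝ η :
    (Fin n → ℝ) →ₗ[ℝ] ℝ)).intervalIntegral_comp_comm (hg.intervalIntegrable a b)).symm

theorem gramian_mulVec {n m : ℕ} {F : ℝ → Matrix (Fin n) (Fin m) ℝ} (hF : Continuous F)
    (a b : ℝ) (η : Fin n → ℝ) :
    (∫ τ in a..b, F τ * (F τ)ᵀ) *ᵥ η = ∫ τ in a..b, F τ *ᵥ ((F τ)ᵀ *ᵥ η) := by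
  rw [integral_mulVec (hF.matrix_mul hF.matrix_transpose)]
  simp only [mulVec_mulVec]

theorem dotProduct_gramian_mulVec {n m : ℕ} {F : ℝ → Matrix (Fin n) (Fin m) ℝ}
    (hF : Continuous F) (a b : ℝ) (η : Fin n → ℝ) :
    η ⬝ᵥ ((∫ τ in a..b, F τ * (F τ)ᵀ) *ᵥ η) =
      ∫ τ in a..b, ((F τ)ᵀ *ᵥ η) ⬝ᵥ ((F τ)ᵀ *ᵥ η) := by
  rw [gramian_mulVec hF, dotProduct_integral _
    (hF.matrix_mulVec (hF.matrix_transpose.matrix_mulVec continuous_const))]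
  simp only [dotProduct_mulVec, mulVec_transpose]

theorem dotProduct_self_nonneg {n : ℕ} (v : Fin n → ℝ) : 0 ≤ v ⬝ᵥ v :=
  Finset.sum_nonneg fun _ _ => mul_self_nonneg _

theorem dotProduct_self_pos {n : ℕ} {v : Fin n → ℝ} (hv : v ≠ 0) : 0 < v ⬝ᵥ v :=
  lt_of_le_of_ne (dotProduct_self_nonneg v) fun h => hv (dotProduct_self_eq_zero.1 h.symm)

theorem dotProduct_gramian_mono {n m : ℕ} {F : ℝ → Matrix (Fin n) (Fin m) ℝ}
    (hF : Continuous F) {a b a' b' : ℝ} (ha : a' ≤ a) (hab : a ≤ b) (hb : b ≤ b')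
    (η : Fin n → ℝ) :
    η ⬝ᵥ ((∫ τ in a..b, F τ * (F τ)ᵀ) *ᵥ η) ≤ η ⬝ᵥ ((∫ τ in a'..b', F τ * (F τ)ᵀ) *ᵥ η) := by
  have hc : Continuous fun τ => (F τ)ᵀ *ᵥ η := hF.matrix_transpose.matrix_mulVec continuous_const
  rw [dotProduct_gramian_mulVec hF, dotProduct_gramian_mulVec hF]
  refine intervalIntegral.integral_mono_interval ha hab hb
    (Filter.Eventually.of_forall fun τ => dotProduct_self_nonneg _)
    ((hc.dotProduct hc).intervalIntegrable _ _)

theorem gramian_coercive {n m : ℕ} {Ψ : ℝ → Matrix (Fin n) (Fin n) ℝ}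
    {B : ℝ → Matrix (Fin n) (Fin m) ℝ} {a b β : ℝ}
    (h : ((∫ τ in a..b, Ψ τ * B τ * (B τ)ᵀ * (Ψ τ)ᵀ) -
      β • (1 : Matrix (Fin n) (Fin n) ℝ)).PosDef) (η : Fin n → ℝ) :
    β * (η ⬝ᵥ η) ≤ η ⬝ᵥ ((∫ τ in a..b, (Ψ τ * B τ) * (Ψ τ * B τ)ᵀ) *ᵥ η) := by
  have h1 := h.posSemidef.dotProduct_mulVec_nonneg η
  rw [star_trivial, sub_mulVec, dotProduct_sub, smul_mulVec, one_mulVec,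
    dotProduct_smul, smul_eq_mul] at h1
  simp only [transpose_mul, ← Matrix.mul_assoc] at h1 ⊢
  linarith

theorem isUnit_det_of_dotProduct_pos {n : ℕ} {W : Matrix (Fin n) (Fin n) ℝ}
    (hW : ∀ η, η ≠ 0 → 0 < η ⬝ᵥ (W *ᵥ η)) : IsUnit W.det := by
  rw [isUnit_iff_ne_zero]
  intro h
  obtain ⟨v, hv, hv0⟩ := exists_mulVec_eq_zero_iff.2 h
  have := hW v hv
  simp [hv0] at this

theorem eq_zero_of_integral_dotProduct_self {n : ℕ} {v : ℝ → Fin n → ℝ} (hv : Continuous v)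
    {a b : ℝ} (hab : a < b) (h : ∫ τ in a..b, v τ ⬝ᵥ v τ = 0) : ∀ τ ∈ Icc a b, v τ = 0 := by
  intro τ hτ
  by_contra hne
  have := intervalIntegral.integral_pos hab (hv.dotProduct hv).continuousOn
    (fun r _ => dotProduct_self_nonneg (v r))
    ⟨τ, hτ, dotProduct_self_pos hne⟩
  exact this.ne' h

/-- A continuous function orthogonal to the kernel of `v ↦ ∫ F v` on all large windows is of the
form `Fᵀ η`. -/
theorem exists_eq_transpose_mulVec {n m : ℕ} {F : ℝ → Matrix (Fin n) (Fin m) ℝ}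
    (hF : Continuous F) {w : ℝ → Fin m → ℝ} (hw : Continuous w) {s : ℝ} (hs : 0 < s)
    (hpos : ∀ η, η ≠ 0 → 0 < η ⬝ᵥ ((∫ τ in (0 : ℝ)..s, F τ * (F τ)ᵀ) *ᵥ η))
    (h : ∀ a ≤ 0, ∀ b ≥ s, ∀ v : ℝ → Fin m → ℝ, Continuous v → ∫ τ in a..b, F τ *ᵥ v τ = 0 →
      ∫ τ in a..b, v τ ⬝ᵥ w τ = 0) :
    ∃ η, ∀ τ, w τ = (F τ)ᵀ *ᵥ η := by
  have key : ∀ a ≤ 0, ∀ b ≥ s, ∃ η, ∀ τ ∈ Icc a b, w τ = (F τ)ᵀ *ᵥ η := by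
    intro a ha b hb
    have hWpos : ∀ η, η ≠ 0 → 0 < η ⬝ᵥ ((∫ τ in a..b, F τ * (F τ)ᵀ) *ᵥ η) := fun η hη =>
      (hpos η hη).trans_le (dotProduct_gramian_mono hF ha hs.le hb η)
    have hWu := isUnit_det_of_dotProduct_pos hWpos
    set W := ∫ τ in a..b, F τ * (F τ)ᵀ with hWdef
    -- `(F τ)ᵀ *ᵥ η` is the `L²` projection of `w` on the functions of this form: the remainder `v`
    -- satisfies `∫ F v = 0`, so the hypothesis makes it orthogonal to `w`, hence to itself.
    set η := W⁻¹ *ᵥ ∫ τ in a..b, F τ *ᵥ w τ with hη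
    have hWη : W *ᵥ η = ∫ τ in a..b, F τ *ᵥ w τ := by
      rw [hη, mulVec_mulVec, mul_nonsing_inv _ hWu, one_mulVec]
    have hcη : Continuous fun τ => (F τ)ᵀ *ᵥ η :=
      hF.matrix_transpose.matrix_mulVec continuous_const
    set v : ℝ → Fin m → ℝ := fun τ => w τ - (F τ)ᵀ *ᵥ η with hv
    have hvc : Continuous v := hw.sub hcη
    have hFv : ∫ τ in a..b, F τ *ᵥ v τ = 0 := by
      simp only [hv, mulVec_sub]
      rw [intervalIntegral.integral_sub ((hF.matrix_mulVec hw).intervalIntegrable _ _)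
        ((hF.matrix_mulVec hcη).intervalIntegrable _ _), ← gramian_mulVec hF, ← hWdef, hWη,
        sub_self]
    have hvw := h a ha b hb v hvc hFv
    have hvv : ∫ τ in a..b, v τ ⬝ᵥ v τ = 0 := by
      have h1 : ∀ τ, v τ ⬝ᵥ v τ = v τ ⬝ᵥ w τ - η ⬝ᵥ (F τ *ᵥ v τ) := by
        intro τ
        conv_lhs => rw [hv]
        rw [← dotProduct_transpose_mulVec, ← dotProduct_sub]
      simp only [h1]
      rw [intervalIntegral.integral_sub ((hvc.dotProduct hw).intervalIntegrable _ _)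
        ((continuous_const.dotProduct (hF.matrix_mulVec hvc)).intervalIntegrable _ _), hvw,
        ← dotProduct_integral _ (hF.matrix_mulVec hvc), hFv]
      simp
    exact ⟨η, fun τ hτ => sub_eq_zero.1
      (eq_zero_of_integral_dotProduct_self hvc (by linarith) hvv τ hτ)⟩
  obtain ⟨η, hη⟩ := key 0 le_rfl s le_rfl
  refine ⟨η, fun τ => ?_⟩
  obtain ⟨η', hη'⟩ := key (min 0 τ) (min_le_left _ _) (max s τ) (le_max_left _ _)
  -- Both vectors represent `w` on `[0, s]`, where the Gramian is positive; so `η` does not depend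
  -- on the window.
  have hsub : η' = η := by
    by_contra hne
    have := hpos (η' - η) (sub_ne_zero.2 hne)
    rw [dotProduct_gramian_mulVec hF, intervalIntegral.integral_congr (g := fun _ => 0)] at this
    · simp at this
    · intro r hr
      rw [uIcc_of_le hs.le] at hr
      have h1 := hη r hr
      have h2 := hη' r ⟨(min_le_left _ _).trans hr.1, hr.2.trans (le_max_left _ _)⟩
      have : (F r)ᵀ *ᵥ (η' - η) = 0 := by rw [mulVec_sub, ← h1, ← h2, sub_self]
      simp [this]
  rw [← hsub]
  exact hη' τ ⟨min_le_right _ _, le_max_right _ _⟩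

/-! ### The necessary condition -/

/-- Differentiating the two integral equations almost everywhere gives `B u = B v`. Thus the cost of
a trajectory does not depend on which control witnesses that it is minimizing. -/
theorem IsTrajectory.control_ae_eq {n m : ℕ} {A : ℝ → Matrix (Fin n) (Fin n) ℝ}
    {B : ℝ → Matrix (Fin n) (Fin m) ℝ} (hA : Continuous A) (hB : Continuous B)
    (hinj : ∀ t, Function.Injective (fun v : Fin m → ℝ => B t *ᵥ v)) {a b : ℝ} (hab : a ≤ b)
    {u v : ℝ → Fin m → ℝ} {x : ℝ → Fin n → ℝ}
    (hu : IsTrajectory A B a b u x) (hv : IsTrajectory A B a b v x) :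
    ∀ᵐ t, t ∈ uIoc a b → u t = v t := by
  have hui := hu.intervalIntegrable hab hA hB
  have hvi := hv.intervalIntegrable hab hA hB
  have hne : ∀ᵐ t : ℝ, t ≠ b := by simp [ae_iff, measure_singleton]
  filter_upwards [(hui.sub hvi).ae_hasDerivAt_integral, hne] with t ht htb hmem
  have hd := ht (uIoc_subset_uIcc hmem) a (by simp)
  rw [uIoc_of_le hab] at hmem
  have hz : (fun r => ∫ τ in a..r, ((fun t => A t *ᵥ x t + B t *ᵥ u t) -
      fun t => A t *ᵥ x t + B t *ᵥ v t) τ) =ᶠ[nhds t] fun _ => 0 := by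
    filter_upwards [Ioo_mem_nhds hmem.1 (lt_of_le_of_ne hmem.2 htb)] with r hr
    have hsub : uIcc a r ⊆ uIcc a b := by
      rw [uIcc_of_le hab, uIcc_of_le hr.1.le]; exact Icc_subset_Icc_right hr.2.le
    simp only [Pi.sub_apply]
    rw [intervalIntegral.integral_sub (hui.mono_set hsub) (hvi.mono_set hsub), sub_eq_zero]
    exact add_left_cancel ((hu.integral_eq r ⟨hr.1.le, hr.2.le⟩).symm.trans
      (hv.integral_eq r ⟨hr.1.le, hr.2.le⟩))
  have := hd.unique (hz.hasDerivAt_iff.2 (hasDerivAt_const t 0))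
  simp only [add_sub_add_left_eq_sub, sub_eq_zero] at this
  exact hinj t this

theorem IsTrajectory.add_smul {n m : ℕ} {A : ℝ → Matrix (Fin n) (Fin n) ℝ}
    {B : ℝ → Matrix (Fin n) (Fin m) ℝ} (hA : Continuous A) (hB : Continuous B) {a b : ℝ}
    {u w : ℝ → Fin m → ℝ} {x z : ℝ → Fin n → ℝ} (hu : Continuous u) (hw : Continuous w)
    (hx : ∀ t, HasDerivAt x (A t *ᵥ x t + B t *ᵥ u t) t)
    (hz : ∀ t, HasDerivAt z (A t *ᵥ z t + B t *ᵥ w t) t) (ε : ℝ) :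
    IsTrajectory A B a b (fun t => u t + ε • w t) (fun t => x t + ε • z t) := by
  refine .of_hasDerivAt hA hB (hu.add (hw.const_smul ε)) (fun t => ?_) a b
  have : A t *ᵥ (x t + ε • z t) + B t *ᵥ (u t + ε • w t) =
      (A t *ᵥ x t + B t *ᵥ u t) + ε • (A t *ᵥ z t + B t *ᵥ w t) := by
    simp only [mulVec_add, mulVec_smul, smul_add]
    abel
  exact this ▸ (hx t).add ((hz t).const_smul ε)

/-- First variation: the cost of `x + ε z` minus that of `x` is a nonnegative quadratic in `ε`
without constant term, so its discriminant forces the linear coefficient to vanish. -/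
theorem IsMinimizing.integral_bil_eq_zero {n m : ℕ} {A : ℝ → Matrix (Fin n) (Fin n) ℝ}
    {B : ℝ → Matrix (Fin n) (Fin m) ℝ} {c : QuadCost n m} (hc : c.Admissible)
    (hA : Continuous A) (hB : Continuous B)
    (hinj : ∀ t, Function.Injective (fun v : Fin m → ℝ => B t *ᵥ v)) {a b : ℝ} (hab : a ≤ b)
    {u w : ℝ → Fin m → ℝ} {x z : ℝ → Fin n → ℝ} (hmin : IsMinimizing A B c a b x)
    (hu : Continuous u) (hw : Continuous w)
    (hx : ∀ t, HasDerivAt x (A t *ᵥ x t + B t *ᵥ u t) t)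
    (hz : ∀ t, HasDerivAt z (A t *ᵥ z t + B t *ᵥ w t) t) (hza : z a = 0) (hzb : z b = 0) :
    ∫ t in a..b, c.bil t (x t) (u t) (z t) (w t) = 0 := by
  obtain ⟨u', hu', hle⟩ := hmin
  have hxT := IsTrajectory.of_hasDerivAt hA hB hu hx a b
  have hzT := IsTrajectory.of_hasDerivAt hA hB hw hz a b
  have htot : c.total a b u' x = c.total a b u x := by
    refine intervalIntegral.integral_congr_ae ?_
    filter_upwards [hu'.control_ae_eq hA hB hinj hab hxT] with t ht hmem
    rw [ht hmem]
  have hxi := hxT.intervalIntegrable_eval hc hab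
  have hzi := hzT.intervalIntegrable_eval hc hab
  have hbi : IntervalIntegrable (fun t => c.bil t (x t) (u t) (z t) (w t)) volume a b := by
    have h1 := (IsTrajectory.add_smul (a := a) (b := b) hA hB hu hw hx hz 1
      ).intervalIntegrable_eval hc hab
    refine (((h1.sub hxi).sub hzi).const_mul (1 / 2)).congr fun t _ => ?_
    simp only [hc.eval_add_smul]
    ring
  have hq : ∀ ε : ℝ, 0 ≤ c.total a b w z * (ε * ε) +
      2 * (∫ t in a..b, c.bil t (x t) (u t) (z t) (w t)) * ε + 0 := by
    intro ε
    have h := hle _ _ (IsTrajectory.add_smul (a := a) (b := b) hA hB hu hw hx hz ε)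
      (by simp [hza]) (by simp [hzb])
    rw [htot, QuadCost.total, QuadCost.total] at h
    simp only [hc.eval_add_smul] at h
    rw [intervalIntegral.integral_add (hxi.add (hbi.const_mul _)) (hzi.const_mul _),
      intervalIntegral.integral_add hxi (hbi.const_mul _), intervalIntegral.integral_const_mul,
      intervalIntegral.integral_const_mul] at h
    rw [QuadCost.total]
    linarith
  have hd := discrim_le_zero hq
  rw [discrim] at hd
  nlinarith [sq_nonneg (∫ t in a..b, c.bil t (x t) (u t) (z t) (w t))]

/-- Pontryagin's principle on the whole line: a trajectory all of whose restrictions are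
minimizing has a costate. -/
theorem exists_isExtremal {n m : ℕ} {A : ℝ → Matrix (Fin n) (Fin n) ℝ}
    {B : ℝ → Matrix (Fin n) (Fin m) ℝ} (hAB : AdmissibleDynamics A B) {c : QuadCost n m}
    (hc : c.Admissible) {u : ℝ → Fin m → ℝ} {x : ℝ → Fin n → ℝ} (hu : Continuous u)
    (hx : ∀ t, HasDerivAt x (A t *ᵥ x t + B t *ᵥ u t) t)
    (hmin : ∀ a b, a < b → IsMinimizing A B c a b x) :
    ∃ p, IsExtremal A B c x u p := by
  have hA := hAB.smoothBounded_A.1.continuous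
  have hB := hAB.smoothBounded_B.1.continuous
  have hQ := hc.smoothBounded_Q.1.continuous
  have hS := hc.smoothBounded_S.1.continuous
  have hR := hc.smoothBounded_R.1.continuous
  have hxc : Continuous x := continuous_iff_continuousAt.2 fun t => (hx t).continuousAt
  obtain ⟨Φ, hΦ, s, hs, β, hβ, hG⟩ := hAB.uniformlyControllable
  have hadj := hΦ.adjoint hA
  have hA' : Continuous fun t => -(A t)ᵀ := hA.matrix_transpose.neg
  set f : ℝ → Fin n → ℝ := fun t => c.Q t *ᵥ x t + c.S t *ᵥ u t with hf
  have hfc : Continuous f := (hQ.matrix_mulVec hxc).add (hS.matrix_mulVec hu)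
  have hderiv := fun (ξ : Fin n → ℝ) t => hadj.hasDerivAt_variation hA' hfc.neg 0 0 t ξ
  -- `P ξ` is the solution of the costate equation with value `ξ` at time `0`; only stationarity
  -- remains to be arranged through `ξ`.
  set P : (Fin n → ℝ) → ℝ → Fin n → ℝ := fun ξ r => (Φ 0 r)ᵀ *ᵥ
    (ξ + ∫ σ in (0 : ℝ)..r, (Φ σ 0)ᵀ *ᵥ -f σ) with hP
  have hPd : ∀ ξ t, HasDerivAt (P ξ) (-((A t)ᵀ *ᵥ P ξ t) - f t) t := by
    intro ξ t
    rw [← neg_mulVec, sub_eq_add_neg]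
    exact hderiv ξ t
  have hPc : ∀ ξ, Continuous (P ξ) := fun ξ =>
    continuous_iff_continuousAt.2 fun t => (hPd ξ t).continuousAt
  have hF : Continuous fun τ => Φ 0 τ * B τ := (hΦ.continuous_right hA 0).matrix_mul hB
  -- The defect of stationarity for the initial costate `0`.
  set w : ℝ → Fin m → ℝ := fun t => (B t)ᵀ *ᵥ P 0 t + ((c.S t)ᵀ *ᵥ x t + c.R t *ᵥ u t) with hw
  have hwc : Continuous w := (hB.matrix_transpose.matrix_mulVec (hPc 0)).add
    ((hS.matrix_transpose.matrix_mulVec hxc).add (hR.matrix_mulVec hu))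
  obtain ⟨η, hη⟩ := exists_eq_transpose_mulVec hF hwc hs (fun η hne => by
      have h1 := gramian_coercive (hG 0) η
      rw [zero_add] at h1
      exact (mul_pos hβ (dotProduct_self_pos hne)).trans_le h1)
    (fun a ha b hb v hv hFv => by
      have hab : a < b := by linarith
      -- The condition `∫ Φ(0, ·) B v = 0` says exactly that `v` steers `0` at `a` to `0` at `b`, so
      -- the resulting `z` is an admissible variation. Integrating the derivative of `P 0 ⬝ z` then
      -- turns the first variation into `∫ v ⬝ w = 0`.
      have hzd := fun t => hΦ.hasDerivAt_variation hA (hB.matrix_mulVec hv) 0 a t 0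
      set z : ℝ → Fin n → ℝ := fun r => Φ r 0 *ᵥ (0 + ∫ σ in a..r, Φ 0 σ *ᵥ (B σ *ᵥ v σ)) with hz
      have hza : z a = 0 := by simp [hz]
      have hzb : z b = 0 := by
        simp only [← mulVec_mulVec] at hFv
        simp only [hz, hFv, add_zero, mulVec_zero]
      have hbil := (hmin a b hab).integral_bil_eq_zero hc hA hB hAB.injective_B hab.le hu hv hx
        hzd hza hzb
      have hzc : Continuous z := continuous_iff_continuousAt.2 fun t => (hzd t).continuousAt
      have hqz : ∀ t, HasDerivAt (fun r => P 0 r ⬝ᵥ z r)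
          (v t ⬝ᵥ w t - c.bil t (x t) (u t) (z t) (v t)) t := by
        intro t
        refine (hasDerivAt_dotProduct (hPd 0 t) (hzd t)).congr_deriv ?_
        change (-((A t)ᵀ *ᵥ P 0 t) - f t) ⬝ᵥ z t + P 0 t ⬝ᵥ (A t *ᵥ z t + B t *ᵥ v t) =
          v t ⬝ᵥ ((B t)ᵀ *ᵥ P 0 t + ((c.S t)ᵀ *ᵥ x t + c.R t *ᵥ u t)) -
            (z t ⬝ᵥ f t + v t ⬝ᵥ ((c.S t)ᵀ *ᵥ x t + c.R t *ᵥ u t))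
        rw [sub_dotProduct, neg_dotProduct, dotProduct_comm _ (z t), dotProduct_comm _ (z t),
          dotProduct_transpose_mulVec, dotProduct_add (P 0 t), dotProduct_add (v t) ((B t)ᵀ *ᵥ _),
          dotProduct_transpose_mulVec]
        ring
      have hint : Continuous fun t => v t ⬝ᵥ w t - c.bil t (x t) (u t) (z t) (v t) := by
        refine (hv.dotProduct hwc).sub ((hzc.dotProduct hfc).add (hv.dotProduct ?_))
        exact (hS.matrix_transpose.matrix_mulVec hxc).add (hR.matrix_mulVec hu)
      have := intervalIntegral.integral_eq_sub_of_hasDerivAt (fun t _ => hqz t)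
        (hint.intervalIntegrable a b)
      rw [intervalIntegral.integral_sub, hbil, hza, hzb] at this
      · simpa using this
      · exact (hv.dotProduct hwc).intervalIntegrable _ _
      · refine ((hzc.dotProduct hfc).add (hv.dotProduct ?_)).intervalIntegrable _ _
        exact (hS.matrix_transpose.matrix_mulVec hxc).add (hR.matrix_mulVec hu))
  -- Shifting the initial costate by `-η` subtracts `Bᵀ Φ(0, t)ᵀ η`, which is the whole defect.
  refine ⟨P (-η), hu, hx, hPd _, fun t => ?_⟩
  have h1 := hη t
  have h2 : P (-η) t = P 0 t - (Φ 0 t)ᵀ *ᵥ η := by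
    simp only [hP]
    rw [mulVec_add, mulVec_add, mulVec_neg, mulVec_zero, zero_add, neg_add_eq_sub]
  rw [transpose_mul, ← mulVec_mulVec] at h1
  rw [h2, mulVec_sub, ← h1]
  simp only [hw]
  abel

/-! ### Uniformly bounded steering -/

theorem norm_le_of_coercive {n : ℕ} {W : Matrix (Fin n) (Fin n) ℝ} {β : ℝ} (hβ : 0 < β)
    (hW : ∀ η, β * (η ⬝ᵥ η) ≤ η ⬝ᵥ (W *ᵥ η)) (η : Fin n → ℝ) : ‖η‖ ≤ n / β * ‖W *ᵥ η‖ := by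
  rcases (norm_nonneg η).eq_or_lt with h0 | h0
  · rw [← h0]
    positivity
  have h1 : β * ‖η‖ ^ 2 ≤ n * ‖η‖ * ‖W *ᵥ η‖ :=
    (mul_le_mul_of_nonneg_left (sq_norm_le_dotProduct_self η) hβ.le).trans
      ((hW η).trans ((le_abs_self _).trans (norm_dotProduct_le _ _)))
  have h2 : β * ‖η‖ ≤ n * ‖W *ᵥ η‖ := by
    refine le_of_mul_le_mul_left ?_ h0
    linarith
  rw [div_mul_eq_mul_div, le_div_iff₀ hβ]
  linarith

/-- The Gramian control `Fᵀ W⁻¹ δ` does the steering. Coercivity of `W` and the Gronwall bounds are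
uniform over windows of length `s`, hence so is `C`. -/
theorem AdmissibleDynamics.exists_steering {n m : ℕ} {A : ℝ → Matrix (Fin n) (Fin n) ℝ}
    {B : ℝ → Matrix (Fin n) (Fin m) ℝ} (hAB : AdmissibleDynamics A B) :
    ∃ s > 0, ∃ C, 0 ≤ C ∧ ∀ (t : ℝ) (ξ₀ ξ₁ : Fin n → ℝ), ∃ w z, Continuous w ∧
      (∀ r, HasDerivAt z (A r *ᵥ z r + B r *ᵥ w r) r) ∧ z t = ξ₀ ∧ z (t + s) = ξ₁ ∧
      ∀ r ∈ Icc t (t + s), ‖z r‖ + ‖w r‖ ≤ C * (‖ξ₀‖ + ‖ξ₁‖) := by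
  have hA := hAB.smoothBounded_A.1.continuous
  have hB := hAB.smoothBounded_B.1.continuous
  obtain ⟨CA, hCA⟩ := hAB.smoothBounded_A.2
  obtain ⟨CB, hCB⟩ := hAB.smoothBounded_B.2
  have hCB0 : 0 ≤ CB := (norm_nonneg _).trans (hCB 0)
  obtain ⟨Φ, hΦ, s, hs, β, hβ, hG⟩ := hAB.uniformlyControllable
  have hl := hΦ.norm_left_le hCA s
  have hr := hΦ.norm_right_le hA hCA s
  set M := Real.exp (n * CA * s)
  have hM : 0 ≤ M := (Real.exp_pos _).le
  -- `M` bounds the transition matrices on a window and `CF` bounds `Φ B`; `C₁` and `C₂` bound `η`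
  -- and the control relative to `ρ`.
  set CF := n * M * CB
  set C₁ := n / β * (n * M + 1)
  set C₂ := n * CF * C₁
  have hCF : 0 ≤ CF := by positivity
  have hC₁ : 0 ≤ C₁ := by positivity
  have hC₂ : 0 ≤ C₂ := by positivity
  refine ⟨s, hs, n * M * (1 + m * CF * C₂ * s) + C₂, by positivity, fun t ξ₀ ξ₁ => ?_⟩
  set ρ := ‖ξ₀‖ + ‖ξ₁‖
  have hF : Continuous fun τ => Φ t τ * B τ := (hΦ.continuous_right hA t).matrix_mul hB
  have hW := gramian_coercive (hG t)
  set W := ∫ τ in t..(t + s), (Φ t τ * B τ) * (Φ t τ * B τ)ᵀ with hWdef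
  have hWu := isUnit_det_of_dotProduct_pos (W := W) fun η hη =>
    (mul_pos hβ (dotProduct_self_pos hη)).trans_le (hW η)
  set δ := Φ t (t + s) *ᵥ ξ₁ - ξ₀ with hδ
  set η := W⁻¹ *ᵥ δ with hη
  have hWη : W *ᵥ η = δ := by rw [hη, mulVec_mulVec, mul_nonsing_inv _ hWu, one_mulVec]
  have hFn : ∀ r ∈ Icc t (t + s), ‖Φ t r * B r‖ ≤ CF := fun r hr' =>
    (norm_mul_le' _ _).trans (by
      have := hr t r hr'
      have := hCB r
      change _ ≤ n * M * CB
      gcongr)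
  have hδn : ‖δ‖ ≤ (n * M + 1) * ρ := by
    have h1 := hr t (t + s) ⟨by linarith, le_rfl⟩
    have h2 : ‖ξ₁‖ ≤ ρ := le_add_of_nonneg_left (norm_nonneg _)
    have h3 : ‖ξ₀‖ ≤ ρ := le_add_of_nonneg_right (norm_nonneg _)
    calc ‖δ‖ ≤ ‖Φ t (t + s) *ᵥ ξ₁‖ + ‖ξ₀‖ := norm_sub_le _ _
      _ ≤ n * M * ρ + ρ := add_le_add ((norm_mulVec_le _ _).trans (by gcongr)) h3
      _ = _ := by ring
  have hηn : ‖η‖ ≤ C₁ * ρ := by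
    refine (norm_le_of_coercive hβ hW η).trans ?_
    rw [hWη, mul_assoc]
    gcongr
  set w : ℝ → Fin m → ℝ := fun r => (Φ t r * B r)ᵀ *ᵥ η with hw
  have hwc : Continuous w := hF.matrix_transpose.matrix_mulVec continuous_const
  have hwn : ∀ r ∈ Icc t (t + s), ‖w r‖ ≤ C₂ * ρ := fun r hr' => by
    refine (norm_mulVec_le _ _).trans ?_
    rw [norm_transpose]
    have := hFn r hr'
    calc (n : ℝ) * ‖Φ t r * B r‖ * ‖η‖ ≤ n * CF * (C₁ * ρ) := by gcongr
      _ = _ := by ring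
  have hzd := fun r => hΦ.hasDerivAt_variation hA (hB.matrix_mulVec hwc) t t r ξ₀
  simp only [mulVec_mulVec _ (Φ t _) (B _)] at hzd
  refine ⟨w, fun r => Φ r t *ᵥ (ξ₀ + ∫ σ in t..r, (Φ t σ * B σ) *ᵥ w σ), hwc, hzd, ?_, ?_, ?_⟩
  · simp [(hΦ t).1]
  · simp only [hw]
    rw [← gramian_mulVec hF, ← hWdef, hWη, hδ, add_sub_cancel, mulVec_mulVec, hΦ.mul_swap hA,
      one_mulVec]
  · intro r hr'
    have hI : ‖∫ σ in t..r, (Φ t σ * B σ) *ᵥ w σ‖ ≤ m * CF * (C₂ * ρ) * s := by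
      refine (intervalIntegral.norm_integral_le_of_norm_le_const
        (C := m * CF * (C₂ * ρ)) fun σ hσ => ?_).trans ?_
      · rw [uIoc_of_le hr'.1] at hσ
        have hσ' : σ ∈ Icc t (t + s) := ⟨hσ.1.le, hσ.2.trans hr'.2⟩
        have h1 := hFn σ hσ'
        have h2 := hwn σ hσ'
        exact (norm_mulVec_le _ _).trans (by gcongr)
      · rw [abs_of_nonneg (by linarith [hr'.1])]
        have := hr'.2
        gcongr
        linarith
    have h3 : ‖ξ₀‖ ≤ ρ := le_add_of_nonneg_right (norm_nonneg _)
    have h4 := hl t r hr'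
    have h5 : ‖Φ r t *ᵥ (ξ₀ + ∫ σ in t..r, (Φ t σ * B σ) *ᵥ w σ)‖ ≤
        n * M * (ρ + m * CF * (C₂ * ρ) * s) :=
      (norm_mulVec_le _ _).trans (by
        have := (norm_add_le _ _).trans (add_le_add h3 hI)
        gcongr)
    have h6 := hwn r hr'
    calc _ ≤ n * M * (ρ + m * CF * (C₂ * ρ) * s) + C₂ * ρ := add_le_add h5 h6
      _ = _ := by ring

theorem AdmissibleDynamics.exists_steering_total_le {n m : ℕ}
    {A : ℝ → Matrix (Fin n) (Fin n) ℝ} {B : ℝ → Matrix (Fin n) (Fin m) ℝ}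
    (hAB : AdmissibleDynamics A B) {c : QuadCost n m} (hc : c.Admissible) :
    ∃ s > 0, ∃ C, 0 ≤ C ∧ ∀ (t : ℝ) (ξ₀ ξ₁ : Fin n → ℝ), ∃ w z, IsTrajectory A B t (t + s) w z ∧
      z t = ξ₀ ∧ z (t + s) = ξ₁ ∧ c.total t (t + s) w z ≤ C * (‖ξ₀‖ + ‖ξ₁‖) ^ 2 := by
  have hA := hAB.smoothBounded_A.1.continuous
  have hB := hAB.smoothBounded_B.1.continuous
  obtain ⟨s, hs, C, hC, h⟩ := hAB.exists_steering
  obtain ⟨D, hD, hle⟩ := hc.exists_eval_le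
  refine ⟨s, hs, s * (D * C ^ 2), by positivity, fun t ξ₀ ξ₁ => ?_⟩
  obtain ⟨w, z, hw, hz, h0, h1, hbd⟩ := h t ξ₀ ξ₁
  have hT := IsTrajectory.of_hasDerivAt hA hB hw hz t (t + s)
  refine ⟨w, z, hT, h0, h1, ?_⟩
  have := intervalIntegral.integral_mono_on (by linarith : t ≤ t + s)
    (hT.intervalIntegrable_eval hc (by linarith)) intervalIntegrable_const
    fun r hr => (hle r (z r) (w r)).trans (mul_le_mul_of_nonneg_left
      (pow_le_pow_left₀ (by positivity) (hbd r hr) 2) hD)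
  rw [intervalIntegral.integral_const, add_sub_cancel_left, smul_eq_mul] at this
  refine this.trans (le_of_eq ?_)
  ring

/-! ### Symplectic orthogonality of vanishing extremals -/

/-- Test the convexity inequality on a trajectory steering `ξ` to `0` during the window: the far
boundary term drops out. Its cost is controlled by `‖ξ‖ ^ 2`, and that of `y` by minimality against
a steered competitor. Applying this to `-ξ` gives the absolute value. -/
theorem AdmissibleDynamics.exists_abs_dotProduct_costate_le {n m : ℕ}
    {A : ℝ → Matrix (Fin n) (Fin n) ℝ} {B : ℝ → Matrix (Fin n) (Fin m) ℝ}
    (hAB : AdmissibleDynamics A B) {c : QuadCost n m} (hc : c.Admissible) :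
    ∃ s > 0, ∃ C, 0 ≤ C ∧ ∀ (y v q), IsExtremal A B c y v q → ∀ (t : ℝ) (ξ : Fin n → ℝ),
      |q t ⬝ᵥ ξ| ≤ C * ((‖y t‖ + ‖y (t + s)‖) ^ 2 + ‖ξ‖ ^ 2) := by
  have hA := hAB.smoothBounded_A.1.continuous
  have hB := hAB.smoothBounded_B.1.continuous
  obtain ⟨s, hs, C, hC, h⟩ := hAB.exists_steering_total_le hc
  refine ⟨s, hs, C, hC, fun y v q hy t ξ => ?_⟩
  have key : ∀ ξ : Fin n → ℝ, q t ⬝ᵥ ξ ≤ C * ((‖y t‖ + ‖y (t + s)‖) ^ 2 + ‖ξ‖ ^ 2) := by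
    intro ξ
    obtain ⟨w, z, hT, h0, h1, hbd⟩ := h t ξ 0
    obtain ⟨w', z', hT', h0', h1', hbd'⟩ := h t (y t) (y (t + s))
    have h2 := hy.total_le hc hA hB (by linarith) hT' h0' h1'
    have h3 := hy.two_mul_le hc hA hB (by linarith) hT
    rw [h0, h1, dotProduct_zero, sub_zero] at h3
    rw [norm_zero, add_zero] at hbd
    have h4 : 0 ≤ C * ((‖y t‖ + ‖y (t + s)‖) ^ 2 + ‖ξ‖ ^ 2) := by positivity
    linarith
  refine abs_le'.2 ⟨key ξ, ?_⟩
  simpa using key (-ξ)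

/-- The Hamiltonian flow preserves the symplectic form, by the symmetry of `Q` and `R`. -/
theorem IsExtremal.wronskian_const {n m : ℕ} {A : ℝ → Matrix (Fin n) (Fin n) ℝ}
    {B : ℝ → Matrix (Fin n) (Fin m) ℝ} {c : QuadCost n m} (hc : c.Admissible) {x u p y v q}
    (hx : IsExtremal A B c x u p) (hy : IsExtremal A B c y v q) (t t' : ℝ) :
    q t ⬝ᵥ x t - p t ⬝ᵥ y t = q t' ⬝ᵥ x t' - p t' ⬝ᵥ y t' := by
  have hd : ∀ r, HasDerivAt (fun r => q r ⬝ᵥ x r - p r ⬝ᵥ y r) 0 r := by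
    intro r
    refine ((hasDerivAt_dotProduct (hy.hasDerivAt_costate r) (hx.hasDerivAt_state r)).sub
      (hasDerivAt_dotProduct (hx.hasDerivAt_costate r) (hy.hasDerivAt_state r))).congr_deriv ?_
    have h1 := congrArg (u r ⬝ᵥ ·) (hy.stationary r)
    have h2 := congrArg (v r ⬝ᵥ ·) (hx.stationary r)
    simp only [dotProduct_add, dotProduct_transpose_mulVec, dotProduct_zero] at h1 h2
    rw [dotProduct_mulVec_comm_of_isSymm (hc.symm_R r)] at h2
    simp only [dotProduct_comm _ (x r), dotProduct_comm _ (y r), dotProduct_sub, dotProduct_neg,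
      dotProduct_add, dotProduct_transpose_mulVec]
    have h3 := dotProduct_mulVec_comm_of_isSymm (hc.symm_Q r) (x r) (y r)
    linarith
  exact is_const_of_deriv_eq_zero (fun r => (hd r).differentiableAt) (fun r => (hd r).deriv) t t'

/-- Each half of the Wronskian tends to zero along `l` by the costate bound with `ξ` the vanishing
state; translation invariance of `l` handles the state at `t + s`. -/
theorem IsExtremal.costate_dotProduct_comm {n m : ℕ} {A : ℝ → Matrix (Fin n) (Fin n) ℝ}
    {B : ℝ → Matrix (Fin n) (Fin m) ℝ} (hAB : AdmissibleDynamics A B) {c : QuadCost n m}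
    (hc : c.Admissible) {l : Filter ℝ} [l.NeBot] (hl : ∀ s : ℝ, Filter.Tendsto (· + s) l l)
    {x u p y v q} (hx : IsExtremal A B c x u p) (hy : IsExtremal A B c y v q)
    (hx0 : Filter.Tendsto x l (nhds 0)) (hy0 : Filter.Tendsto y l (nhds 0)) (t : ℝ) :
    q t ⬝ᵥ x t = p t ⬝ᵥ y t := by
  obtain ⟨s, -, C, -, h⟩ := hAB.exists_abs_dotProduct_costate_le hc
  have key : ∀ {x y : ℝ → Fin n → ℝ} {v q}, IsExtremal A B c y v q →
      Filter.Tendsto x l (nhds 0) → Filter.Tendsto y l (nhds 0) →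
      Filter.Tendsto (fun r => q r ⬝ᵥ x r) l (nhds 0) := by
    intro x y v q hy hx0 hy0
    refine squeeze_zero_norm (fun r => h y v q hy r (x r)) ?_
    have := ((((hy0.norm.add (hy0.comp (hl s)).norm).pow 2).add (hx0.norm.pow 2)).const_mul C)
    simpa using this
  have h1 := (key hy hx0 hy0).sub (key hx hy0 hx0)
  rw [sub_zero] at h1
  have h2 : (fun r => q r ⬝ᵥ x r - p r ⬝ᵥ y r) = fun _ => q t ⬝ᵥ x t - p t ⬝ᵥ y t :=
    funext fun r => hx.wronskian_const hc hy r t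
  rw [h2] at h1
  exact sub_eq_zero.1 (tendsto_nhds_unique tendsto_const_nhds h1)

/-! ### Riccati solutions and extremals -/

theorem QuadCost.Admissible.continuous_inv_R {n m : ℕ} {c : QuadCost n m} (hc : c.Admissible) :
    Continuous fun t => (c.R t)⁻¹ := by
  have hR := hc.smoothBounded_R.1.continuous
  simp only [inv_def, Ring.inverse_eq_inv']
  exact (hR.matrix_det.inv₀ fun t => (hc.isUnit_det_R t).ne_zero).smul hR.matrix_adjugate

/-- The feedback gain of a solution of the Riccati equation. -/
noncomputable def feedback {n m : ℕ} (B : ℝ → Matrix (Fin n) (Fin m) ℝ) (c : QuadCost n m)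
    (P : ℝ → Matrix (Fin n) (Fin n) ℝ) (t : ℝ) : Matrix (Fin m) (Fin n) ℝ :=
  -((c.R t)⁻¹ * ((c.S t)ᵀ + (B t)ᵀ * P t))

theorem closedLoop_eq {n m : ℕ} (A : ℝ → Matrix (Fin n) (Fin n) ℝ)
    (B : ℝ → Matrix (Fin n) (Fin m) ℝ) (c : QuadCost n m) (P : ℝ → Matrix (Fin n) (Fin n) ℝ)
    (t : ℝ) : closedLoop A B c P t = A t + B t * feedback B c P t := by
  simp only [closedLoop, feedback, Matrix.mul_neg, Matrix.mul_assoc, sub_eq_add_neg]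

theorem R_mul_feedback {n m : ℕ} {B : ℝ → Matrix (Fin n) (Fin m) ℝ} {c : QuadCost n m}
    (hc : c.Admissible) (P : ℝ → Matrix (Fin n) (Fin n) ℝ) (t : ℝ) :
    c.R t * feedback B c P t = -((c.S t)ᵀ + (B t)ᵀ * P t) := by
  rw [feedback, Matrix.mul_neg, ← Matrix.mul_assoc, mul_nonsing_inv _ (hc.isUnit_det_R t),
    Matrix.one_mul]

theorem IsRiccatiSolution.continuous {n m : ℕ} {A : ℝ → Matrix (Fin n) (Fin n) ℝ}
    {B : ℝ → Matrix (Fin n) (Fin m) ℝ} {c : QuadCost n m} {P}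
    (hP : IsRiccatiSolution A B c P) : Continuous P :=
  continuous_iff_continuousAt.2 fun t => (hP.2 t).continuousAt

theorem IsRiccatiSolution.continuous_feedback {n m : ℕ} {A : ℝ → Matrix (Fin n) (Fin n) ℝ}
    {B : ℝ → Matrix (Fin n) (Fin m) ℝ} {c : QuadCost n m} {P}
    (hP : IsRiccatiSolution A B c P) (hc : c.Admissible) (hB : Continuous B) :
    Continuous (feedback B c P) :=
  (hc.continuous_inv_R.matrix_mul (hc.smoothBounded_S.1.continuous.matrix_transpose.add
    (hB.matrix_transpose.matrix_mul hP.continuous))).neg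

/-- Stationarity is the definition of the gain, and the Riccati equation is the costate equation for
`p = P x`. -/
theorem IsRiccatiSolution.isExtremal {n m : ℕ} {A : ℝ → Matrix (Fin n) (Fin n) ℝ}
    {B : ℝ → Matrix (Fin n) (Fin m) ℝ} {c : QuadCost n m} {P}
    (hP : IsRiccatiSolution A B c P) (hc : c.Admissible) (hB : Continuous B) {Ψ}
    (hΨ : IsTransitionMatrix (closedLoop A B c P) Ψ) (τ : ℝ) (ξ : Fin n → ℝ) :
    IsExtremal A B c (fun t => Ψ t τ *ᵥ ξ) (fun t => feedback B c P t *ᵥ (Ψ t τ *ᵥ ξ))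
      (fun t => P t *ᵥ (Ψ t τ *ᵥ ξ)) := by
  refine ⟨?_, fun t => ?_, fun t => ?_, fun t => ?_⟩
  · exact (hP.continuous_feedback hc hB).matrix_mulVec
      ((hΨ.continuous_left τ).matrix_mulVec continuous_const)
  · have := hΨ.hasDerivAt_mulVec t τ ξ
    rwa [closedLoop_eq, add_mulVec, ← mulVec_mulVec _ (B t)] at this
  · refine (hasDerivAt_mulVec (hP.2 t) (hΨ.hasDerivAt_mulVec t τ ξ)).congr_deriv ?_
    generalize Ψ t τ *ᵥ ξ = y
    have h1 : (c.R t)⁻¹ * ((B t)ᵀ * P t + (c.S t)ᵀ) = -feedback B c P t := by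
      rw [feedback, neg_neg, add_comm]
    have h2 : -(P t * A t) - (A t)ᵀ * P t +
        (P t * B t + c.S t) * (c.R t)⁻¹ * ((B t)ᵀ * P t + (c.S t)ᵀ) - c.Q t +
        P t * closedLoop A B c P t =
        -((A t)ᵀ * P t) - (c.Q t + c.S t * feedback B c P t) := by
      rw [Matrix.mul_assoc (_ + _) (c.R t)⁻¹, h1, closedLoop_eq]
      simp only [Matrix.add_mul, Matrix.mul_neg, Matrix.mul_add, Matrix.mul_assoc]
      abel
    rw [mulVec_mulVec, ← add_mulVec, h2]
    simp only [sub_mulVec, neg_mulVec, add_mulVec, mulVec_mulVec]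
  · generalize Ψ t τ *ᵥ ξ = y
    rw [mulVec_mulVec, mulVec_mulVec, R_mul_feedback hc, neg_mulVec, add_mulVec]
    abel

/-- A closed-loop matrix of `c` whose trajectories vanish along `l` is a closed-loop matrix of
every equivalent cost. -/
theorem exists_isRiccatiSolution_of_costEquiv {n m : ℕ} {A : ℝ → Matrix (Fin n) (Fin n) ℝ}
    {B : ℝ → Matrix (Fin n) (Fin m) ℝ} (hAB : AdmissibleDynamics A B) {c c' : QuadCost n m}
    (hc : c.Admissible) (hc' : c'.Admissible) (hequiv : CostEquiv A B c c')
    {l : Filter ℝ} [l.NeBot] (hl : ∀ s : ℝ, Filter.Tendsto (· + s) l l)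
    {P} (hP : IsRiccatiSolution A B c P) {Ψ} (hΨ : IsTransitionMatrix (closedLoop A B c P) Ψ)
    (hΨ0 : ∀ τ (ξ : Fin n → ℝ), Filter.Tendsto (fun t => Ψ t τ *ᵥ ξ) l (nhds 0)) :
    ∃ P', IsRiccatiSolution A B c' P' ∧ closedLoop A B c P = closedLoop A B c' P' := by
  have hA := hAB.smoothBounded_A.1.continuous
  have hB := hAB.smoothBounded_B.1.continuous
  have hK := hP.continuous_feedback hc hB
  have hX : Continuous (closedLoop A B c P) := by
    rw [funext (closedLoop_eq A B c P)]
    exact hA.add (hB.matrix_mul hK)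
  set K := feedback B c P
  have hex : ∀ i : Fin n, ∃ p, IsExtremal A B c' (fun t => Ψ t 0 *ᵥ Pi.single i 1)
      (fun t => K t *ᵥ (Ψ t 0 *ᵥ Pi.single i 1)) p := fun i => by
    have hi := hP.isExtremal hc hB hΨ 0 (Pi.single i 1)
    refine exists_isExtremal hAB hc' hi.continuous_control hi.hasDerivAt_state fun a b hab => ?_
    have hmem : (a, b, fun t => Ψ t 0 *ᵥ Pi.single i 1) ∈ optimalSynthesis A B c :=
      ⟨hab, hi.isMinimizing hc hA hB hab.le⟩
    rw [hequiv] at hmem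
    exact hmem.2
  choose p hp using hex
  set Λ : ℝ → Matrix (Fin n) (Fin n) ℝ := fun t => Matrix.of fun k i => p i t k with hΛ
  have hcol : ∀ t i, (Λ t) *ᵥ Pi.single i 1 = p i t := fun t i => by
    ext k
    simp [hΛ]
  have hΛd : ∀ t, HasDerivAt Λ
      (-((A t)ᵀ * Λ t) - (c'.Q t * Ψ t 0 + c'.S t * (K t * Ψ t 0))) t := by
    intro t
    rw [hasDerivAt_matrix_iff]
    intro k i
    have := hasDerivAt_pi.1 ((hp i).hasDerivAt_costate t) k
    refine this.congr_deriv ?_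
    rw [← hcol, mulVec_mulVec, mulVec_mulVec, mulVec_mulVec, mulVec_mulVec, ← neg_mulVec,
      ← add_mulVec, ← sub_mulVec]
    simp [Matrix.mul_assoc]
  have hstat : ∀ t, (B t)ᵀ * Λ t + ((c'.S t)ᵀ * Ψ t 0 + c'.R t * (K t * Ψ t 0)) = 0 := by
    intro t
    refine ext_of_mulVec_single fun i => ?_
    have := (hp i).stationary t
    rw [← hcol] at this
    simpa only [mulVec_mulVec, ← add_mulVec, zero_mulVec, Matrix.mul_assoc] using this
  -- The frame `(Ψ, Λ)` is isotropic: this is where the decay along `l` enters.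
  have hsymm : ∀ t, ((Ψ t 0)ᵀ * Λ t).IsSymm := by
    intro t
    ext i j
    have := (hp i).costate_dotProduct_comm hAB hc' hl (hp j) (hΨ0 0 _) (hΨ0 0 _) t
    simp only [mulVec_single_one] at this
    simpa [mul_apply, dotProduct, hΛ, mul_comm] using this.symm
  set N : ℝ → Matrix (Fin n) (Fin n) ℝ := fun t => Ψ 0 t
  have hN2 : ∀ t, Ψ t 0 * N t = 1 := fun t => hΨ.mul_swap hX t 0
  have hfb : ∀ t, (B t)ᵀ * (Λ t * N t) + ((c'.S t)ᵀ + c'.R t * K t) = 0 := by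
    intro t
    have := congrArg (· * N t) (hstat t)
    simpa only [Matrix.add_mul, Matrix.mul_assoc, hN2, Matrix.mul_one, Matrix.zero_mul]
      using this
  have hKeq : ∀ t, K t = feedback B c' (fun r => Λ r * N r) t := by
    intro t
    have h1 : (c'.S t)ᵀ + (B t)ᵀ * (Λ t * N t) = -(c'.R t * K t) := by
      rw [eq_neg_iff_add_eq_zero, ← hfb t]
      abel
    rw [feedback, h1, Matrix.mul_neg, neg_neg, ← Matrix.mul_assoc,
      nonsing_inv_mul _ (hc'.isUnit_det_R t), Matrix.one_mul]
  refine ⟨fun t => Λ t * N t, ⟨fun t => ?_, fun t => ?_⟩, ?_⟩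
  · have h1 : Λ t * N t = (N t)ᵀ * ((Ψ t 0)ᵀ * Λ t) * N t := by
      rw [← Matrix.mul_assoc (N t)ᵀ, ← transpose_mul, hN2, transpose_one, Matrix.one_mul]
    change (Λ t * N t).IsSymm
    rw [h1, IsSymm, transpose_mul, transpose_mul, transpose_transpose, (hsymm t).eq]
    simp only [Matrix.mul_assoc]
  · refine (hasDerivAt_mul (hΛd t) (hΨ.hasDerivAt_right hX 0 t)).congr_deriv ?_
    change (-((A t)ᵀ * Λ t) - (c'.Q t * Ψ t 0 + c'.S t * (K t * Ψ t 0))) * N t +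
      Λ t * -(N t * closedLoop A B c P t) = _
    rw [closedLoop_eq]
    have h2 : (c'.R t)⁻¹ * ((B t)ᵀ * (Λ t * N t) + (c'.S t)ᵀ) = -K t := by
      rw [hKeq, feedback, neg_neg, add_comm]
    rw [Matrix.mul_assoc (_ + _) (c'.R t)⁻¹, h2]
    change _ * N t + Λ t * -(N t * (A t + B t * K t)) = _
    simp only [Matrix.sub_mul, Matrix.add_mul, Matrix.neg_mul, Matrix.mul_neg, Matrix.mul_add,
      Matrix.mul_assoc, hN2, Matrix.mul_one]
    abel
  · funext t
    rw [closedLoop_eq, closedLoop_eq, ← hKeq]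

/-- Two Riccati solutions whose closed-loop trajectories vanish along `l` coincide. -/
theorem IsRiccatiSolution.eq_of_tendsto {n m : ℕ} {A : ℝ → Matrix (Fin n) (Fin n) ℝ}
    {B : ℝ → Matrix (Fin n) (Fin m) ℝ} (hAB : AdmissibleDynamics A B) {c : QuadCost n m}
    (hc : c.Admissible) {l : Filter ℝ} [l.NeBot] (hl : ∀ s : ℝ, Filter.Tendsto (· + s) l l)
    {P P'} (hP : IsRiccatiSolution A B c P) (hP' : IsRiccatiSolution A B c P') {Ψ Ψ'}
    (hΨ : IsTransitionMatrix (closedLoop A B c P) Ψ)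
    (hΨ' : IsTransitionMatrix (closedLoop A B c P') Ψ')
    (hΨ0 : ∀ τ (ξ : Fin n → ℝ), Filter.Tendsto (fun t => Ψ t τ *ᵥ ξ) l (nhds 0))
    (hΨ0' : ∀ τ (ξ : Fin n → ℝ), Filter.Tendsto (fun t => Ψ' t τ *ᵥ ξ) l (nhds 0)) :
    P = P' := by
  have hB := hAB.smoothBounded_B.1.continuous
  funext t
  refine ext_of_mulVec_single fun i => dotProduct_eq _ _ fun ζ => ?_
  -- At time `t` the two states can be prescribed freely, so orthogonality reads `P' ζ ⬝ eᵢ = P eᵢ ⬝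
  -- ζ` for every `ζ`.
  have h := (hP.isExtremal hc hB hΨ t (Pi.single i 1)).costate_dotProduct_comm hAB hc hl
    (hP'.isExtremal hc hB hΨ' t ζ) (hΨ0 t _) (hΨ0' t _) t
  rw [(hΨ t).1, (hΨ' t).1, one_mulVec, one_mulVec] at h
  rw [← h, dotProduct_comm, dotProduct_mulVec_comm_of_isSymm (hP'.1 t), dotProduct_comm]

/-! ### Stability and vanishing trajectories -/

theorem tendsto_mulVec_of_norm_le {n : ℕ} {l : Filter ℝ} {M : ℝ → Matrix (Fin n) (Fin n) ℝ}
    {f : ℝ → ℝ} (hM : ∀ᶠ t in l, ‖M t‖ ≤ f t) (hf : Filter.Tendsto f l (nhds 0))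
    (ξ : Fin n → ℝ) : Filter.Tendsto (fun t => M t *ᵥ ξ) l (nhds 0) := by
  refine squeeze_zero_norm' (a := fun t => n * f t * ‖ξ‖) ?_ ?_
  · filter_upwards [hM] with t ht
    exact (norm_mulVec_le _ _).trans (by gcongr)
  · simpa using (hf.const_mul (n : ℝ)).mul_const ‖ξ‖

theorem ExpStable.exists_tendsto {n : ℕ} {X : ℝ → Matrix (Fin n) (Fin n) ℝ} (hX : ExpStable X) :
    ∃ Ψ, IsTransitionMatrix X Ψ ∧ ∀ τ (ξ : Fin n → ℝ),
      Filter.Tendsto (fun t => Ψ t τ *ᵥ ξ) Filter.atTop (nhds 0) := by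
  obtain ⟨Ψ, hΨ, α, -, β, hβ, h⟩ := hX
  refine ⟨Ψ, hΨ, fun τ ξ => tendsto_mulVec_of_norm_le
    ((Filter.eventually_ge_atTop τ).mono fun t ht => h τ t ht) ?_ ξ⟩
  have h1 : Filter.Tendsto (fun t : ℝ => -β * (t - τ)) Filter.atTop Filter.atBot :=
    (Filter.tendsto_atTop_add_const_right _ (-τ) Filter.tendsto_id).const_mul_atTop_of_neg
      (neg_neg_of_pos hβ)
  simpa using (Real.tendsto_exp_atBot.comp h1).const_mul α

theorem ExpAntiStable.exists_tendsto {n : ℕ} {X : ℝ → Matrix (Fin n) (Fin n) ℝ}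
    (hX : ExpAntiStable X) :
    ∃ Ψ, IsTransitionMatrix X Ψ ∧ ∀ τ (ξ : Fin n → ℝ),
      Filter.Tendsto (fun t => Ψ t τ *ᵥ ξ) Filter.atBot (nhds 0) := by
  obtain ⟨Ψ, hΨ, α, -, β, hβ, h⟩ := hX
  refine ⟨Ψ, hΨ, fun τ ξ => tendsto_mulVec_of_norm_le
    ((Filter.eventually_le_atBot τ).mono fun t ht => h τ t ht) ?_ ξ⟩
  have h1 : Filter.Tendsto (fun t : ℝ => β * (t - τ)) Filter.atBot Filter.atBot :=
    (Filter.tendsto_atBot_add_const_right _ (-τ) Filter.tendsto_id).const_mul_atBot hβ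
  simpa using (Real.tendsto_exp_atBot.comp h1).const_mul α

theorem tendsto_add_const_atTop (s : ℝ) :
    Filter.Tendsto (fun t : ℝ => t + s) Filter.atTop Filter.atTop :=
  Filter.tendsto_atTop_add_const_right _ s Filter.tendsto_id

theorem tendsto_add_const_atBot (s : ℝ) :
    Filter.Tendsto (fun t : ℝ => t + s) Filter.atBot Filter.atBot :=
  Filter.tendsto_atBot_add_const_right _ s Filter.tendsto_id

/-! ### Invariance of the stable and anti-stable closed-loop maps -/

/-- The matrix `X` itself is unchanged, so its stability carries over; only a Riccati solution of
`c'` realizing it had to be found. -/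
theorem IsAPlus.of_costEquiv {n m : ℕ} {A : ℝ → Matrix (Fin n) (Fin n) ℝ}
    {B : ℝ → Matrix (Fin n) (Fin m) ℝ} (hAB : AdmissibleDynamics A B) {c c' : QuadCost n m}
    (hc : c.Admissible) (hc' : c'.Admissible) (hequiv : CostEquiv A B c c') {X}
    (hX : IsAPlus A B c X) : IsAPlus A B c' X := by
  obtain ⟨P, hP, rfl, hst⟩ := hX
  obtain ⟨Ψ, hΨ, hΨ0⟩ := hst.exists_tendsto
  obtain ⟨P', hP', hX'⟩ := exists_isRiccatiSolution_of_costEquiv hAB hc hc' hequiv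
    tendsto_add_const_atTop hP hΨ hΨ0
  exact ⟨P', hP', hX', hst⟩

theorem IsAMinus.of_costEquiv {n m : ℕ} {A : ℝ → Matrix (Fin n) (Fin n) ℝ}
    {B : ℝ → Matrix (Fin n) (Fin m) ℝ} (hAB : AdmissibleDynamics A B) {c c' : QuadCost n m}
    (hc : c.Admissible) (hc' : c'.Admissible) (hequiv : CostEquiv A B c c') {X}
    (hX : IsAMinus A B c X) : IsAMinus A B c' X := by
  obtain ⟨P, hP, rfl, hst⟩ := hX
  obtain ⟨Ψ, hΨ, hΨ0⟩ := hst.exists_tendsto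
  obtain ⟨P', hP', hX'⟩ := exists_isRiccatiSolution_of_costEquiv hAB hc hc' hequiv
    tendsto_add_const_atBot hP hΨ hΨ0
  exact ⟨P', hP', hX', hst⟩

theorem IsAPlus.unique {n m : ℕ} {A : ℝ → Matrix (Fin n) (Fin n) ℝ}
    {B : ℝ → Matrix (Fin n) (Fin m) ℝ} (hAB : AdmissibleDynamics A B) {c : QuadCost n m}
    (hc : c.Admissible) {X X'} (hX : IsAPlus A B c X) (hX' : IsAPlus A B c X') : X = X' := by
  obtain ⟨P, hP, rfl, hst⟩ := hX
  obtain ⟨P', hP', rfl, hst'⟩ := hX'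
  obtain ⟨Ψ, hΨ, hΨ0⟩ := hst.exists_tendsto
  obtain ⟨Ψ', hΨ', hΨ0'⟩ := hst'.exists_tendsto
  rw [hP.eq_of_tendsto hAB hc tendsto_add_const_atTop hP' hΨ hΨ' hΨ0 hΨ0']

theorem IsAMinus.unique {n m : ℕ} {A : ℝ → Matrix (Fin n) (Fin n) ℝ}
    {B : ℝ → Matrix (Fin n) (Fin m) ℝ} (hAB : AdmissibleDynamics A B) {c : QuadCost n m}
    (hc : c.Admissible) {X X'} (hX : IsAMinus A B c X) (hX' : IsAMinus A B c X') : X = X' := by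
  obtain ⟨P, hP, rfl, hst⟩ := hX
  obtain ⟨P', hP', rfl, hst'⟩ := hX'
  obtain ⟨Ψ, hΨ, hΨ0⟩ := hst.exists_tendsto
  obtain ⟨Ψ', hΨ', hΨ0'⟩ := hst'.exists_tendsto
  rw [hP.eq_of_tendsto hAB hc tendsto_add_const_atBot hP' hΨ hΨ' hΨ0 hΨ0']

end LQ

theorem mainTheorem10 {n m : ℕ}
    (A : ℝ → Matrix (Fin n) (Fin n) ℝ) (B : ℝ → Matrix (Fin n) (Fin m) ℝ)
    (hAB : LQ.AdmissibleDynamics A B)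
    (c c' : LQ.QuadCost n m) (hc : c.Admissible) (hc' : c'.Admissible)
    (hequiv : LQ.CostEquiv A B c c') :
    ((∀ X, LQ.IsAPlus A B c X ↔ LQ.IsAPlus A B c' X) ∧
      (∀ X, LQ.IsAMinus A B c X ↔ LQ.IsAMinus A B c' X)) ∧
    ((∀ X X', LQ.IsAPlus A B c X → LQ.IsAPlus A B c' X' → X = X') ∧
      (∀ X X', LQ.IsAMinus A B c X → LQ.IsAMinus A B c' X' → X = X')) := by
  have hequiv' : LQ.CostEquiv A B c' c := Eq.symm hequiv
  exact ⟨⟨fun X => ⟨fun h => h.of_costEquiv hAB hc hc' hequiv,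
      fun h => h.of_costEquiv hAB hc' hc hequiv'⟩,
    fun X => ⟨fun h => h.of_costEquiv hAB hc hc' hequiv,
      fun h => h.of_costEquiv hAB hc' hc hequiv'⟩⟩,
    -- Transporting `X'` back to `c` reduces the comparison to uniqueness for a single cost.
    fun X X' h h' => h.unique hAB hc (h'.of_costEquiv hAB hc' hc hequiv'),
    fun X X' h h' => h.unique hAB hc (h'.of_costEquiv hAB hc' hc hequiv')⟩
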